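/- Let $H_A=\mathbb C^a$, $H_B=\mathbb C^b$, $H_C=\mathbb C^c$. For a bipartite pure state $|\varphi\rangle\in\mathbb C^m\otimes\mathbb C^n$ with reduced density matrix $\rho_1$ on the first factor put, for even $m$, $$E^{rm}(|\varphi\rangle)=1-\sum_{i=1}^{m/2}\Big[\tfrac{4i}{m^2+2m}\mathrm{Tr}(\rho_1^i)+\tfrac{2m-4i+4}{m^2+2m}\mathrm{Tr}(\rho_1^{i+m/2})\Big],$$ and, for odd $m$, $$E^{rm}(|\varphi\rangle)=1-\sum_{i=1}^{(m-1)/2}\Big[\tfrac{4i}{(m+1)^2}\mathrm{Tr}(\rho_1^i)+\tfrac{2m-4i+2}{(m+1)^2}\mathrm{Tr}(\rho_1^{\frac{m+1}{2}+i})\Big]-\tfrac{2}{m+1}\mathrm{Tr}(\rho_1^{\frac{m+1}{2}}).$$ For a pure state $|\psi\rangle\in H_A\otimes H_B\otimes H_C$ let $$E_{GTE}(|\psi\rangle)=\big[E^{rm}(|\psi\rangle_{A|BC})\,E^{rm}(|\psi\rangle_{B|AC})\,E^{rm}(|\psi\rangle_{C|AB})\big]^{1/3},$$ where the reduced state in each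 factor is that of the single party $A$, $B$ or $C$. For a density matrix $\rho$ on $H_A\otimes H_B\otimes H_C$ let $E_{GTE}(\rho)=\min\sum_i p_iE_{GTE}(|\psi_i\rangle)$, the minimum being over all finite decompositions $\rho=\sum_ip_i|\psi_i\rangle\langle\psi_i|$ with $p_i\ge0$, $\sum_ip_i=1$ and unit vectors $|\psi_i\rangle$. A state is biseparable if it is a convex combination of pure states each of which is a product across at least one of the bipartitions $A|BC$, $B|AC$, $C|AB$, and genuinely tripartite entangled otherwise. **Theorem.** $E_{GTE}$ is a genuine tripartite entanglement measure. That is: the minimum is attained for every state, and on pure states $E_{GTE}(|\psi\rangle\langle\psi|)=E_{GTE}(|\psi\rangle)$; and 1. $E_{GTE}(\rho)\ge0$ for every state $\rho$, $E_{GTE}(\rho)=0$ if $\rho$ is biseparable, and $E_{GTE}(\rho)>0$ if $\rho$ is genuinely tripartite entangled; 2. $E_{GTE}((U\otimes V\otimes W)\rho(U\otimes V\otimes W)^\dagger)=E_{GTE}(\rho)$ for all unitaries $U,V,W$ on $H_A,H_B,H_C$; 3. $E_{GTE}$ does not increase on average under stochastic LOCC: if a finite-round LOCC protocol from $H_A\otimes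 H_B\otimes H_C$ to itself takes $\rho$ to the state $\rho_x$ with probability $p_x$, then $\sum_xp_xE_{GTE}(\rho_x)\le E_{GTE}(\rho)$; 4. $E_{GTE}$ is convex on the set of states; 5. $E_{GTE}(\Lambda(\rho))\le E_{GTE}(\rho)$ for every state $\rho$ and every (finite-round) LOCC map $\Lambda$ from $H_A\otimes H_B\otimes H_C$ to itself. -/

import Mathlib

open scoped Kronecker ComplexOrder

noncomputable section

namespace GTE

/-! ### States -/

/-- A density matrix (a quantum state) on the Hilbert space `ℂ^ι`. -/
def IsState {ι : Type*} [Fintype ι] (ρ : Matrix ι ι ℂ) : Prop :=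
  ρ.PosSemidef ∧ ρ.trace = 1

/-- The rank-one operator `|ψ⟩⟨ψ|`. -/
def ketbra {ι : Type*} (ψ : EuclideanSpace ℂ ι) : Matrix ι ι ℂ :=
  Matrix.of fun x y => ψ x * star (ψ y)

/-- `{p i, |ψ i⟩}` is a (finite) pure state decomposition of `ρ`. -/
structure IsPureDecomposition {ι : Type*} [Fintype ι] (ρ : Matrix ι ι ℂ) {n : ℕ}
    (p : Fin n → ℝ) (ψ : Fin n → EuclideanSpace ℂ ι) : Prop where
  nonneg : ∀ i, 0 ≤ p i
  sum_eq_one : ∑ i, p i = 1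
  norm_eq_one : ∀ i, ‖ψ i‖ = 1
  eq_sum : ρ = ∑ i, p i • ketbra (ψ i)

/-! ### The bipartite pure state measure -/

/-- The reduced density matrix `Tr_B |ψ⟩⟨ψ|` of a vector `ψ ∈ ℂ^ι ⊗ ℂ^κ`. -/
def reduced {ι κ : Type*} [Fintype κ] (ψ : EuclideanSpace ℂ (ι × κ)) : Matrix ι ι ℂ :=
  Matrix.of fun i j => ∑ x, ψ (i, x) * star (ψ (j, x))

/-- The `k`-th moment `Tr (ρ_A ^ k)` of the reduced density matrix (a real number). -/
def moment {m : ℕ} {κ : Type*} [Fintype κ] (ψ : EuclideanSpace ℂ (Fin m × κ)) (k : ℕ) : ℝ :=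
  ((reduced ψ ^ k).trace).re

/-- The measure `E^{rm}` of a bipartite pure state in `ℂ^m ⊗ ℂ^κ`, based on the moments of the
reduced state on the first factor, of dimension `m`. -/
def Erm {m : ℕ} {κ : Type*} [Fintype κ] (ψ : EuclideanSpace ℂ (Fin m × κ)) : ℝ :=
  if Even m then
    1 - ∑ i ∈ Finset.Icc 1 (m / 2),
      (4 * (i : ℝ) / ((m : ℝ) ^ 2 + 2 * m) * moment ψ i
        + (2 * (m : ℝ) - 4 * i + 4) / ((m : ℝ) ^ 2 + 2 * m) * moment ψ (i + m / 2))
  else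
    1 - (∑ i ∈ Finset.Icc 1 ((m - 1) / 2),
        (4 * (i : ℝ) / ((m : ℝ) + 1) ^ 2 * moment ψ i
          + (2 * (m : ℝ) - 4 * i + 2) / ((m : ℝ) + 1) ^ 2 * moment ψ ((m + 1) / 2 + i))
      + 2 / ((m : ℝ) + 1) * moment ψ ((m + 1) / 2))

/-! ### Tripartite systems `ℂ^a ⊗ ℂ^b ⊗ ℂ^c` -/

/-- The index set of the product basis of `ℂ^a ⊗ ℂ^b ⊗ ℂ^c`. -/
abbrev Idx (a b c : ℕ) : Type := Fin a × Fin b × Fin c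

/-- Vectors of `ℂ^a ⊗ ℂ^b ⊗ ℂ^c`. -/
abbrev Ket (a b c : ℕ) : Type := EuclideanSpace ℂ (Idx a b c)

/-- Operators on `ℂ^a ⊗ ℂ^b ⊗ ℂ^c`. -/
abbrev Op (a b c : ℕ) : Type := Matrix (Idx a b c) (Idx a b c) ℂ

/-- `ψ` as a vector of the bipartite system `A|BC`. -/
def cutA {a b c : ℕ} (ψ : Ket a b c) : EuclideanSpace ℂ (Fin a × (Fin b × Fin c)) :=
  WithLp.toLp 2 fun x => ψ (x.1, x.2.1, x.2.2)

/-- `ψ` as a vector of the bipartite system `B|AC`. -/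
def cutB {a b c : ℕ} (ψ : Ket a b c) : EuclideanSpace ℂ (Fin b × (Fin a × Fin c)) :=
  WithLp.toLp 2 fun x => ψ (x.2.1, x.1, x.2.2)

/-- `ψ` as a vector of the bipartite system `C|AB`. -/
def cutC {a b c : ℕ} (ψ : Ket a b c) : EuclideanSpace ℂ (Fin c × (Fin a × Fin b)) :=
  WithLp.toLp 2 fun x => ψ (x.2.1, x.2.2, x.1)

/-- `E_GTE` of a pure state: the geometric mean of `E^{rm}` over the three bipartitions. -/
def EgtePure {a b c : ℕ} (ψ : Ket a b c) : ℝ :=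
  (Erm (cutA ψ) * Erm (cutB ψ) * Erm (cutC ψ)) ^ (1 / 3 : ℝ)

/-- The average values `∑ p i * E_GTE (ψ i)` over all pure state decompositions of `ρ`. -/
def roofValues {a b c : ℕ} (ρ : Op a b c) : Set ℝ :=
  {v | ∃ (n : ℕ) (p : Fin n → ℝ) (ψ : Fin n → Ket a b c),
    IsPureDecomposition ρ p ψ ∧ v = ∑ i, p i * EgtePure (ψ i)}

/-- `E_GTE` of a mixed state: the convex roof extension of `EgtePure`. -/
def Egte {a b c : ℕ} (ρ : Op a b c) : ℝ := sInf (roofValues ρ)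

/-! ### Biseparability -/

/-- A bipartite vector which is a product vector `φ ⊗ χ`. -/
def IsProduct {ι κ : Type*} (ψ : EuclideanSpace ℂ (ι × κ)) : Prop :=
  ∃ (φ : EuclideanSpace ℂ ι) (χ : EuclideanSpace ℂ κ), ∀ i x, ψ (i, x) = φ i * χ x

/-- A tripartite pure state is biseparable if it is a product across some bipartition. -/
def IsBiseparablePure {a b c : ℕ} (ψ : Ket a b c) : Prop :=
  IsProduct (cutA ψ) ∨ IsProduct (cutB ψ) ∨ IsProduct (cutC ψ)

/-- A state is biseparable if it is a convex mixture of biseparable pure states (which may be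
products across different bipartitions). -/
def IsBiseparable {a b c : ℕ} (ρ : Op a b c) : Prop :=
  ∃ (n : ℕ) (p : Fin n → ℝ) (ψ : Fin n → Ket a b c),
    IsPureDecomposition ρ p ψ ∧ ∀ i, IsBiseparablePure (ψ i)

/-- A genuinely tripartite entangled state: a state which is not biseparable. -/
def IsGenuinelyEntangled {a b c : ℕ} (ρ : Op a b c) : Prop :=
  IsState ρ ∧ ¬ IsBiseparable ρ

/-! ### Local operations and classical communication -/

/-- The local operator `K ⊗ L ⊗ M`. -/
def localOp {a b c a' b' c' : ℕ} (K : Matrix (Fin a') (Fin a) ℂ) (L : Matrix (Fin b') (Fin b) ℂ)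
    (M : Matrix (Fin c') (Fin c) ℂ) : Matrix (Idx a' b' c') (Idx a b c) ℂ :=
  K ⊗ₖ (L ⊗ₖ M)

/-- Conjugation `ρ ↦ T ρ T†`. -/
def conj {ι κ : Type*} [Fintype ι] (T : Matrix κ ι ℂ) (ρ : Matrix ι ι ℂ) : Matrix κ κ ℂ :=
  T * ρ * T.conjTranspose

/-- Finite-round LOCC protocols which take the system `ℂ^a ⊗ ℂ^b ⊗ ℂ^c` to `ℂ^a' ⊗ ℂ^b' ⊗ ℂ^c'`
and end with a classical record in `Fin k`. In each round one party applies a local quantum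
instrument, given by Kraus operators `K i` with `∑ (K i)† (K i) = 1`, and broadcasts the outcome
`i`; the rest of the protocol may depend on all earlier outcomes. The dimension of the acting
party's system may change (local ancillas may be added and discarded). Several branches may end
with the same record, so that outcomes can also be kept secret or be forgotten. -/
inductive Protocol (k a' b' c' : ℕ) : ℕ → ℕ → ℕ → Type
  | halt (x : Fin k) : Protocol k a' b' c' a' b' c'
  | actA {a b c n : ℕ} (r : Fin n → ℕ) (K : ∀ i, Matrix (Fin (r i)) (Fin a) ℂ)
      (hK : ∑ i, (K i).conjTranspose * K i = 1)
      (next : ∀ i, Protocol k a' b' c' (r i) b c) : Protocol k a' b' c' a b c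
  | actB {a b c n : ℕ} (r : Fin n → ℕ) (K : ∀ i, Matrix (Fin (r i)) (Fin b) ℂ)
      (hK : ∑ i, (K i).conjTranspose * K i = 1)
      (next : ∀ i, Protocol k a' b' c' a (r i) c) : Protocol k a' b' c' a b c
  | actC {a b c n : ℕ} (r : Fin n → ℕ) (K : ∀ i, Matrix (Fin (r i)) (Fin c) ℂ)
      (hK : ∑ i, (K i).conjTranspose * K i = 1)
      (next : ∀ i, Protocol k a' b' c' a b (r i)) : Protocol k a' b' c' a b c

/-- The unnormalized state after the protocol, given that its record is `x`: the `x`-th map of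
the LOCC instrument. Its trace is the probability of the record `x`. -/
def Protocol.branch {k a' b' c' : ℕ} (x : Fin k) :
    {a b c : ℕ} → Protocol k a' b' c' a b c → Op a b c → Op a' b' c'
  | _, _, _, .halt y, ρ => if y = x then ρ else 0
  | _, _, _, .actA _ K _ next, ρ => ∑ i, (next i).branch x (conj (localOp (K i) 1 1) ρ)
  | _, _, _, .actB _ K _ next, ρ => ∑ i, (next i).branch x (conj (localOp 1 (K i) 1) ρ)
  | _, _, _, .actC _ K _ next, ρ => ∑ i, (next i).branch x (conj (localOp 1 1 (K i)) ρ)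

/-- The deterministic LOCC map of a protocol: the record is forgotten. -/
def Protocol.channel {k a b c a' b' c' : ℕ} (P : Protocol k a' b' c' a b c) (ρ : Op a b c) :
    Op a' b' c' :=
  ∑ x, P.branch x ρ

/-- The probability of the record `x`. -/
def Protocol.prob {k a b c a' b' c' : ℕ} (P : Protocol k a' b' c' a b c) (x : Fin k)
    (ρ : Op a b c) : ℝ :=
  ((P.branch x ρ).trace).re

/-- The normalized state after the protocol, given that its record is `x` (meaningful when `x`
has positive probability). -/
def Protocol.post {k a b c a' b' c' : ℕ} (P : Protocol k a' b' c' a b c) (x : Fin k)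
    (ρ : Op a b c) : Op a' b' c' :=
  (P.prob x ρ)⁻¹ • P.branch x ρ

end GTE

end

/-! In either parity of `m`, the coefficients of `Erm` form a single tent of weights `rmWeight m k`,
proportional to `min k (m + 1 - k)`: they are nonnegative, have total one when `m ≠ 0`, and the
second one is positive when `m ≥ 2`. Only these facts about the weights matter.

Monotonicity. The rescaled moment `Tr A ^ k / (Tr A) ^ (k - 1)` is subadditive on positive matrices
(`normMoment_sum_le`), so the homogeneous version `mixedness` of `Erm` is superadditive
(`sum_mixedness_le`). If a party outside a cut's first factor measures, the unnormalized reduced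
matrices of the outcomes add up to the old one, and superadditivity says that the entanglement does
not grow on average. If the first factor itself measures, the same argument applies on the other
side, since `M * Mᴴ` and `Mᴴ * M` have equal positive moments. Hölder's inequality carries this to
the geometric mean of the three cuts (`sum_homEgte_le`). The weights are kept at the final
dimensions throughout, so ancillas added in between do no harm.

Faithfulness. For a unit vector, `mixedness` vanishes only if the purity is one, and then all 2×2
minors of the coefficient matrix vanish (`sum_sum_normSq_minor`), which makes the vector a product.

Mixed states. The values averaged by the roof form the fibre over `ρ` of the convex hull of the
compact graph `pureGraph`. Compactness gives an attained minimum, convexity of the hull gives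
convexity of `Egte`. For LOCC the hull is replaced by the cone `ensembleCone`, in which
probabilities are absorbed into the vectors; induction on the protocol moves a point of the cone
through every branch. -/

open scoped Kronecker ComplexOrder

noncomputable section

namespace GTE

open Matrix

/-! ### Two scalar inequalities: Jensen for a perspective function, and Hölder. -/

section Scalar

/-- Joint convexity of `x ^ k / t ^ (k - 1)` in its subadditive form. -/
theorem sum_pow_div_le {ι : Type*} [Fintype ι] (k : ℕ) (x t : ι → ℝ) (hx : ∀ i, 0 ≤ x i)
    (hxt : ∀ i, x i ≤ t i) :
    (∑ i, x i) ^ (k + 1) / (∑ i, t i) ^ k ≤ ∑ i, x i ^ (k + 1) / t i ^ k := by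
  have ht : ∀ i, 0 ≤ t i := fun i => (hx i).trans (hxt i)
  rcases (Finset.sum_nonneg fun i _ => ht i : 0 ≤ ∑ i, t i).eq_or_lt with h0 | hpos
  · have hti : ∀ i, t i = 0 := fun i =>
      (Finset.sum_eq_zero_iff_of_nonneg fun i _ => ht i).1 h0.symm i (Finset.mem_univ i)
    have hxi : ∀ i, x i = 0 := fun i => le_antisymm ((hxt i).trans (hti i).le) (hx i)
    simp [hxi]
  -- Jensen for the points `x i / t i` with weights `t i / ∑ t`. Where `t i = 0`, the bound `x i ≤ t
  -- i` forces `x i = 0`, so division by zero is harmless.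
  · have hjensen := Real.pow_arith_mean_le_arith_mean_pow Finset.univ
      (fun i => t i / ∑ j, t j) (fun i => x i / t i) (fun i _ => div_nonneg (ht i) hpos.le)
      (by rw [← Finset.sum_div, div_self hpos.ne']) (fun i _ => div_nonneg (hx i) (ht i)) (k + 1)
    have h1 : ∀ i, t i / (∑ j, t j) * (x i / t i) = x i / ∑ j, t j := by
      intro i
      rcases (ht i).eq_or_lt with h | h
      · have : x i = 0 := le_antisymm ((hxt i).trans h.ge) (hx i)
        simp [this]
      · field_simp
    have h2 : ∀ i, t i / (∑ j, t j) * (x i / t i) ^ (k + 1)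
        = (x i ^ (k + 1) / t i ^ k) / ∑ j, t j := by
      intro i
      rcases (ht i).eq_or_lt with h | h
      · have : x i = 0 := le_antisymm ((hxt i).trans h.ge) (hx i)
        simp [this]
      · rw [div_pow, pow_succ (t i)]
        field_simp
    simp only [h1, h2] at hjensen
    rw [← Finset.sum_div, ← Finset.sum_div, div_pow, div_le_div_iff₀ (by positivity) hpos] at hjensen
    rw [div_le_iff₀ (by positivity)]
    rw [pow_succ (∑ j, t j), ← mul_assoc] at hjensen
    exact le_of_mul_le_mul_right hjensen hpos

/-- Hölder's inequality for three geometric means. -/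
theorem sum_geom_mean_le {ι : Type*} [Fintype ι] (x y z : ι → ℝ) (hx : ∀ i, 0 ≤ x i)
    (hy : ∀ i, 0 ≤ y i) (hz : ∀ i, 0 ≤ z i) :
    ∑ i, (x i * y i * z i) ^ (1 / 3 : ℝ)
      ≤ ((∑ i, x i) * (∑ i, y i) * ∑ i, z i) ^ (1 / 3 : ℝ) := by
  have hX : 0 ≤ ∑ i, x i := Finset.sum_nonneg fun i _ => hx i
  have hY : 0 ≤ ∑ i, y i := Finset.sum_nonneg fun i _ => hy i
  have hZ : 0 ≤ ∑ i, z i := Finset.sum_nonneg fun i _ => hz i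
  have hzero : ∀ w : ι → ℝ, (∀ i, 0 ≤ w i) → 0 = ∑ i, w i → ∀ i, w i = 0 := fun w hw h i =>
    (Finset.sum_eq_zero_iff_of_nonneg fun i _ => hw i).1 h.symm i (Finset.mem_univ i)
  rcases hX.eq_or_lt with h | hX
  · simp [hzero x hx h]
  rcases hY.eq_or_lt with h | hY
  · simp [hzero y hy h]
  rcases hZ.eq_or_lt with h | hZ
  · simp [hzero z hz h]
  set X := ∑ i, x i with hXd
  set Y := ∑ i, y i with hYd
  set Z := ∑ i, z i with hZd
  -- AM-GM for the shares of each total; the right-hand brackets sum to one over `i`.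
  have key : ∀ i, (x i * y i * z i) ^ (1 / 3 : ℝ)
      ≤ (X * Y * Z) ^ (1 / 3 : ℝ) * (1 / 3 * (x i / X) + 1 / 3 * (y i / Y) + 1 / 3 * (z i / Z)) := by
    intro i
    have h1 := div_nonneg (hx i) hX.le
    have h2 := div_nonneg (hy i) hY.le
    have h3 := div_nonneg (hz i) hZ.le
    have ham := Real.geom_mean_le_arith_mean3_weighted (w₁ := 1 / 3) (w₂ := 1 / 3) (w₃ := 1 / 3)
      (by norm_num) (by norm_num) (by norm_num) h1 h2 h3 (by norm_num)
    rw [← Real.mul_rpow h1 h2, ← Real.mul_rpow (mul_nonneg h1 h2) h3] at ham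
    have heq : x i * y i * z i = X * Y * Z * (x i / X * (y i / Y) * (z i / Z)) := by
      field_simp
    rw [heq, Real.mul_rpow (by positivity) (by positivity)]
    exact mul_le_mul_of_nonneg_left ham (by positivity)
  refine (Finset.sum_le_sum fun i _ => key i).trans ?_
  rw [← Finset.mul_sum, Finset.sum_add_distrib, Finset.sum_add_distrib, ← Finset.mul_sum,
    ← Finset.mul_sum, ← Finset.mul_sum, ← Finset.sum_div, ← Finset.sum_div, ← Finset.sum_div,
    ← hXd, ← hYd, ← hZd, div_self hX.ne', div_self hY.ne', div_self hZ.ne']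
  norm_num

end Scalar

/-! ### Diagonal entries and trace of a positive matrix. -/

section PosSemidef

variable {ι : Type*}

theorem re_diag_nonneg {A : Matrix ι ι ℂ} (hA : A.PosSemidef) (j : ι) : 0 ≤ (A j j).re :=
  (Complex.nonneg_iff.1 hA.diag_nonneg).1

variable [Fintype ι]

theorem re_trace_nonneg {A : Matrix ι ι ℂ} (hA : A.PosSemidef) : 0 ≤ A.trace.re :=
  (Complex.nonneg_iff.1 hA.trace_nonneg).1

theorem re_diag_le_re_trace {A : Matrix ι ι ℂ} (hA : A.PosSemidef) (j : ι) :
    (A j j).re ≤ A.trace.re := by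
  rw [Matrix.trace, Complex.re_sum]
  exact Finset.single_le_sum (f := fun i => (A.diag i).re) (fun i _ => re_diag_nonneg hA i)
    (Finset.mem_univ j)

end PosSemidef

/-! ### Moments of positive matrices and their subadditive normalization. -/

section Moments

variable {ι κ : Type*} [Fintype ι] [DecidableEq ι] [Fintype κ] [DecidableEq κ]

theorem unitary_conj_pow (U : Matrix.unitaryGroup ι ℂ) (A : Matrix ι ι ℂ) (k : ℕ) :
    (star (U : Matrix ι ι ℂ) * A * U) ^ k = star (U : Matrix ι ι ℂ) * A ^ k * U := by
  have h := U.2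
  rw [Matrix.mem_unitaryGroup_iff] at h
  have h' := U.2
  rw [Matrix.mem_unitaryGroup_iff'] at h'
  induction k with
  | zero => simp [h']
  | succ k ih =>
    rw [pow_succ, ih, pow_succ]
    calc star (U : Matrix ι ι ℂ) * A ^ k * U * (star (U : Matrix ι ι ℂ) * A * U)
        = star (U : Matrix ι ι ℂ) * A ^ k * (U * star (U : Matrix ι ι ℂ)) * A * U := by
          simp only [Matrix.mul_assoc]
      _ = _ := by rw [h]; simp only [Matrix.mul_assoc, Matrix.one_mul]

theorem trace_unitary_conj_pow (U : Matrix.unitaryGroup ι ℂ) (A : Matrix ι ι ℂ) (k : ℕ) :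
    ((star (U : Matrix ι ι ℂ) * A * U) ^ k).trace = (A ^ k).trace := by
  have h := U.2
  rw [Matrix.mem_unitaryGroup_iff] at h
  rw [unitary_conj_pow, Matrix.trace_mul_comm, ← Matrix.mul_assoc, h, Matrix.one_mul]

theorem exists_unitary_conj_eq_diagonal {A : Matrix ι ι ℂ} (hA : A.PosSemidef) :
    ∃ (U : Matrix.unitaryGroup ι ℂ) (d : ι → ℝ), (∀ i, 0 ≤ d i) ∧
      star (U : Matrix ι ι ℂ) * A * U = Matrix.diagonal (fun i => (d i : ℂ)) := by
  refine ⟨hA.1.eigenvectorUnitary, hA.1.eigenvalues, hA.eigenvalues_nonneg, ?_⟩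
  have := hA.1.conjStarAlgAut_star_eigenvectorUnitary
  rw [Unitary.conjStarAlgAut_apply] at this
  simpa [Function.comp_def] using this

theorem exists_unitary_diagonal_eq {A : Matrix ι ι ℂ} (hA : A.PosSemidef) :
    ∃ (U : Matrix.unitaryGroup ι ℂ) (d : ι → ℝ), (∀ i, 0 ≤ d i) ∧ ∀ k : ℕ,
      A ^ k = U * Matrix.diagonal (fun i => ((d i ^ k : ℝ) : ℂ)) * star (U : Matrix ι ι ℂ) := by
  obtain ⟨U, d, hd, h⟩ := exists_unitary_conj_eq_diagonal hA
  refine ⟨U, d, hd, fun k => ?_⟩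
  have hU := U.2
  rw [Matrix.mem_unitaryGroup_iff] at hU
  have hk := unitary_conj_pow U A k
  rw [h, Matrix.diagonal_pow] at hk
  have : (fun i => ((d i ^ k : ℝ) : ℂ)) = (fun i => (d i : ℂ)) ^ k := by ext i; simp
  rw [this, hk]
  simp only [Matrix.mul_assoc, hU]
  simp only [← Matrix.mul_assoc, hU]
  simp

/-- Jensen's inequality for a diagonal entry of a power of a positive matrix. -/
theorem re_diag_pow_le {A : Matrix ι ι ℂ} (hA : A.PosSemidef) (k : ℕ) (j : ι) :
    (A j j).re ^ k ≤ ((A ^ k) j j).re := by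
  obtain ⟨U, d, hd, h⟩ := exists_unitary_diagonal_eq hA
  have entry : ∀ k : ℕ, ((A ^ k) j j).re
      = ∑ l, Complex.normSq ((U : Matrix ι ι ℂ) j l) * d l ^ k := by
    intro k
    rw [h k, Matrix.mul_apply, Complex.re_sum]
    refine Finset.sum_congr rfl fun l _ => ?_
    rw [Matrix.mul_diagonal, Matrix.star_apply, mul_right_comm]
    rw [show star ((U : Matrix ι ι ℂ) j l) = (starRingEnd ℂ) ((U : Matrix ι ι ℂ) j l) from rfl,
      Complex.mul_conj, ← Complex.ofReal_mul, Complex.ofReal_re]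
  have h1 := entry 1
  have h0 := entry 0
  rw [pow_one] at h1
  simp only [pow_zero, mul_one, Matrix.one_apply_eq, Complex.one_re, pow_one] at h0 h1
  rw [h1, entry k]
  exact Real.pow_arith_mean_le_arith_mean_pow _ _ _ (fun l _ => Complex.normSq_nonneg _) h0.symm
    (fun l _ => hd l) k

/-- The `k`-th moment of a positive matrix, normalized to be homogeneous of degree one. -/
def normMoment (k : ℕ) (A : Matrix ι ι ℂ) : ℝ :=
  (A ^ k).trace.re / A.trace.re ^ (k - 1)

/-- In an eigenbasis of the sum, its eigenvalues are the sums of the diagonal entries of the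
summands, so `sum_pow_div_le` applies to each coordinate. Restoring the off-diagonal entries of each
summand can only raise its moment, by `re_diag_pow_le`. -/
theorem normMoment_sum_le {n : Type*} [Fintype n] (k : ℕ) (A : n → Matrix ι ι ℂ)
    (hA : ∀ i, (A i).PosSemidef) :
    normMoment (k + 1) (∑ i, A i) ≤ ∑ i, normMoment (k + 1) (A i) := by
  have hsum : (∑ i, A i).PosSemidef := Matrix.posSemidef_sum _ fun i _ => hA i
  obtain ⟨U, d, hd, h⟩ := exists_unitary_conj_eq_diagonal hsum
  set B : n → Matrix ι ι ℂ := fun i => star (U : Matrix ι ι ℂ) * A i * U with hB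
  have hBpos : ∀ i, (B i).PosSemidef := fun i => (hA i).conjTranspose_mul_mul_same _
  have hBsum : ∑ i, B i = Matrix.diagonal (fun j => (d j : ℂ)) := by
    rw [← h, Finset.mul_sum, Finset.sum_mul]
  have hdj : ∀ j, d j = ∑ i, (B i j j).re := by
    intro j
    have := congrArg (fun M : Matrix ι ι ℂ => (M j j).re) hBsum
    simp only [Matrix.sum_apply, Complex.re_sum, Matrix.diagonal_apply_eq,
      Complex.ofReal_re] at this
    exact this.symm
  have htr : ∀ i k, ((B i) ^ k).trace = (A i ^ k).trace := fun i k => trace_unitary_conj_pow U _ k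
  have htr1 : ∀ i, (B i).trace = (A i).trace := fun i => by simpa using htr i 1
  have hmom : ((∑ i, A i) ^ (k + 1)).trace.re = ∑ j, (∑ i, (B i j j).re) ^ (k + 1) := by
    rw [← trace_unitary_conj_pow U, h, Matrix.diagonal_pow, Matrix.trace_diagonal, Complex.re_sum]
    refine Finset.sum_congr rfl fun j _ => ?_
    rw [← hdj, Pi.pow_apply, ← Complex.ofReal_pow, Complex.ofReal_re]
  have hT : (∑ i, A i).trace.re = ∑ i, (B i).trace.re := by
    rw [Matrix.trace_sum, Complex.re_sum]
    exact Finset.sum_congr rfl fun i _ => by rw [htr1]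
  unfold normMoment
  rw [hmom, hT, Nat.add_sub_cancel, Finset.sum_div]
  calc ∑ j, (∑ i, (B i j j).re) ^ (k + 1) / (∑ i, (B i).trace.re) ^ k
      ≤ ∑ j, ∑ i, (B i j j).re ^ (k + 1) / (B i).trace.re ^ k :=
        Finset.sum_le_sum fun j _ => sum_pow_div_le k _ _ (fun i => re_diag_nonneg (hBpos i) j)
          fun i => re_diag_le_re_trace (hBpos i) j
    _ = ∑ i, (∑ j, (B i j j).re ^ (k + 1)) / (B i).trace.re ^ k := by
        rw [Finset.sum_comm]
        simp only [Finset.sum_div]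
    _ ≤ _ := by
        refine Finset.sum_le_sum fun i _ => ?_
        rw [← htr, ← htr1]
        refine div_le_div_of_nonneg_right ?_ (pow_nonneg (re_trace_nonneg (hBpos i)) k)
        rw [Matrix.trace, Complex.re_sum]
        exact Finset.sum_le_sum fun j _ => re_diag_pow_le (hBpos i) _ j

/-- Each eigenvalue is at most the trace, so all but one factor of `d j ^ (k + 1)` can be bounded by
it. -/
theorem normMoment_le_re_trace {A : Matrix ι ι ℂ} (hA : A.PosSemidef) (k : ℕ) :
    normMoment (k + 1) A ≤ A.trace.re := by
  obtain ⟨U, d, hd, h⟩ := exists_unitary_conj_eq_diagonal hA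
  have hmom : ∀ k, (A ^ k).trace.re = ∑ j, d j ^ k := by
    intro k
    rw [← trace_unitary_conj_pow U, h, Matrix.diagonal_pow, Matrix.trace_diagonal, Complex.re_sum]
    refine Finset.sum_congr rfl fun j _ => ?_
    rw [Pi.pow_apply, ← Complex.ofReal_pow, Complex.ofReal_re]
  have ht : A.trace.re = ∑ j, d j := by simpa using hmom 1
  have h0 : 0 ≤ ∑ j, d j := Finset.sum_nonneg fun j _ => hd j
  unfold normMoment
  rw [hmom, ht, Nat.add_sub_cancel]
  refine div_le_of_le_mul₀ (pow_nonneg h0 k) h0 ?_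
  rw [Finset.sum_mul]
  refine Finset.sum_le_sum fun j _ => ?_
  rw [pow_succ']
  exact mul_le_mul_of_nonneg_left
    (pow_le_pow_left₀ (hd j) (Finset.single_le_sum (fun i _ => hd i) (Finset.mem_univ j)) k) (hd j)

theorem normMoment_smul (k : ℕ) {r : ℝ} (hr : 0 ≤ r) (A : Matrix ι ι ℂ) :
    normMoment (k + 1) (r • A) = r * normMoment (k + 1) A := by
  unfold normMoment
  rw [smul_pow, Matrix.trace_smul, Matrix.trace_smul, Complex.smul_re, Complex.smul_re,
    Nat.add_sub_cancel, smul_eq_mul, smul_eq_mul, mul_pow, pow_succ]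
  rcases hr.eq_or_lt with h | h
  · simp [← h]
  · field_simp

/-- The exponent must be positive: the zeroth moment sees the dimension, which differs on the two
sides. -/
theorem trace_mul_comm_pow (M : Matrix ι κ ℂ) (N : Matrix κ ι ℂ) (k : ℕ) :
    ((M * N) ^ (k + 1)).trace = ((N * M) ^ (k + 1)).trace := by
  have h : ∀ k : ℕ, (M * N) ^ k * M = M * (N * M) ^ k := by
    intro k
    induction k with
    | zero => simp
    | succ k ih => rw [pow_succ', Matrix.mul_assoc, ih, pow_succ']; simp only [Matrix.mul_assoc]
  rw [pow_succ, ← Matrix.mul_assoc, h, Matrix.mul_assoc, Matrix.trace_mul_comm, pow_succ,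
    Matrix.mul_assoc]

theorem normMoment_mul_comm (M : Matrix ι κ ℂ) (N : Matrix κ ι ℂ) (k : ℕ) :
    normMoment (k + 1) (M * N) = normMoment (k + 1) (N * M) := by
  unfold normMoment
  rw [trace_mul_comm_pow, Matrix.trace_mul_comm]

end Moments

/-! ### The moment coefficients as one tent-shaped weight. -/

section Weights

/-- The coefficient of the `k`-th moment in `Erm`, in dimension `m`. -/
def rmWeight (m k : ℕ) : ℝ :=
  4 * (min k (m + 1 - k) : ℕ) / (if Even m then (m : ℝ) ^ 2 + 2 * m else ((m : ℝ) + 1) ^ 2)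

theorem rmWeight_nonneg (m k : ℕ) : 0 ≤ rmWeight m k := by
  unfold rmWeight
  split_ifs <;> positivity

/-- Purity is the moment that detects product vectors, so faithfulness rests on this weight. -/
theorem rmWeight_two_pos {m : ℕ} (hm : 2 ≤ m) : 0 < rmWeight m 2 := by
  unfold rmWeight
  have h1 : 0 < min 2 (m + 1 - 2) := by omega
  have h2 : (0 : ℝ) < (min 2 (m + 1 - 2) : ℕ) := by exact_mod_cast h1
  have h3 : (0 : ℝ) < m := by exact_mod_cast (by omega : 0 < m)
  split_ifs <;> positivity

theorem sum_Icc_one_add (n l : ℕ) (g : ℕ → ℝ) :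
    ∑ k ∈ Finset.Icc 1 (n + l), g k
      = ∑ k ∈ Finset.Icc 1 n, g k + ∑ k ∈ Finset.Icc 1 l, g (n + k) := by
  induction l with
  | zero => simp
  | succ l ih =>
    rw [← add_assoc, Finset.sum_Icc_succ_top (by omega), ih, Finset.sum_Icc_succ_top (by omega)]
    ring_nf

/-- With `m = 2n` the coefficients rise as `4i` up to `k = n` and then fall as `4(n + 1 - i)` at `k
= n + i`. -/
theorem sum_rmWeight_even (n : ℕ) (g : ℕ → ℝ) :
    ∑ i ∈ Finset.Icc 1 n, (4 * (i : ℝ) / (((n + n : ℕ) : ℝ) ^ 2 + 2 * (n + n : ℕ)) * g i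
        + (2 * ((n + n : ℕ) : ℝ) - 4 * i + 4) / (((n + n : ℕ) : ℝ) ^ 2 + 2 * (n + n : ℕ)) * g (i + n))
      = ∑ k ∈ Finset.Icc 1 (n + n), rmWeight (n + n) k * g k := by
  rw [sum_Icc_one_add, ← Finset.sum_add_distrib]
  refine Finset.sum_congr rfl fun i hi => ?_
  rw [Finset.mem_Icc] at hi
  unfold rmWeight
  rw [if_pos ⟨n, rfl⟩, show min i (n + n + 1 - i) = i by omega,
    show min (n + i) (n + n + 1 - (n + i)) = n + 1 - i by omega, add_comm n i,
    Nat.cast_sub (by omega)]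
  push_cast
  ring_nf

/-- With `m = 2n + 1` the isolated term `2 / (m + 1)` is the peak of the tent, at `k = n + 1`. -/
theorem sum_rmWeight_odd (n : ℕ) (g : ℕ → ℝ) :
    ∑ i ∈ Finset.Icc 1 n, (4 * (i : ℝ) / (((2 * n + 1 : ℕ) : ℝ) + 1) ^ 2 * g i
        + (2 * ((2 * n + 1 : ℕ) : ℝ) - 4 * i + 2) / (((2 * n + 1 : ℕ) : ℝ) + 1) ^ 2 * g (n + 1 + i))
        + 2 / (((2 * n + 1 : ℕ) : ℝ) + 1) * g (n + 1)
      = ∑ k ∈ Finset.Icc 1 (2 * n + 1), rmWeight (2 * n + 1) k * g k := by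
  have hsplit := sum_Icc_one_add (n + 1) n fun k => rmWeight (2 * n + 1) k * g k
  rw [← show 2 * n + 1 = n + 1 + n by ring] at hsplit
  rw [hsplit, Finset.sum_Icc_succ_top (by omega), add_right_comm, ← Finset.sum_add_distrib]
  have hodd : ¬ Even (2 * n + 1) := by simp
  congr 1
  · refine Finset.sum_congr rfl fun i hi => ?_
    rw [Finset.mem_Icc] at hi
    unfold rmWeight
    rw [if_neg hodd, show min i (2 * n + 1 + 1 - i) = i by omega,
      show min (n + 1 + i) (2 * n + 1 + 1 - (n + 1 + i)) = n + 1 - i by omega,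
      Nat.cast_sub (by omega)]
    push_cast
    ring_nf
  · unfold rmWeight
    rw [if_neg hodd, show min (n + 1) (2 * n + 1 + 1 - (n + 1)) = n + 1 by omega]
    have : ((2 * n + 1 : ℕ) : ℝ) + 1 = 2 * ((n : ℝ) + 1) := by push_cast; ring
    rw [this]
    have : (n : ℝ) + 1 ≠ 0 := by positivity
    push_cast
    congr 1
    field_simp
    norm_num

theorem sum_rmWeight {m : ℕ} (hm : m ≠ 0) : ∑ k ∈ Finset.Icc 1 m, rmWeight m k = 1 := by
  rcases Nat.even_or_odd m with ⟨n, rfl⟩ | ⟨n, rfl⟩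
  · have h := sum_rmWeight_even n fun _ => 1
    simp only [mul_one] at h
    have hn : (n : ℝ) ≠ 0 := by exact_mod_cast (by omega : n ≠ 0)
    -- The rising and the falling coefficient with the same `i` have a sum independent of `i`.
    rw [← h, Finset.sum_congr rfl fun i _ => by
      rw [← add_div, show 4 * (i : ℝ) + (2 * ((n + n : ℕ) : ℝ) - 4 * i + 4)
        = 2 * ((n + n : ℕ) : ℝ) + 4 by ring], Finset.sum_const, Nat.card_Icc]
    have : (n : ℝ) + 1 ≠ 0 := by positivity
    rw [Nat.add_sub_cancel, nsmul_eq_mul]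
    push_cast
    rw [show ((n : ℝ) + n) ^ 2 + 2 * (n + n) = n * (2 * (n + n) + 4) by ring]
    have : (2 * ((n : ℝ) + n) + 4) ≠ 0 := by positivity
    field_simp
  · have h := sum_rmWeight_odd n fun _ => 1
    simp only [mul_one] at h
    rw [← h, Finset.sum_congr rfl fun i _ => by
      rw [← add_div, show 4 * (i : ℝ) + (2 * ((2 * n + 1 : ℕ) : ℝ) - 4 * i + 2)
        = 2 * (((2 * n + 1 : ℕ) : ℝ) + 1) by push_cast; ring], Finset.sum_const, Nat.card_Icc]
    have : (n : ℝ) + 1 ≠ 0 := by positivity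
    have h2 : ((2 * n + 1 : ℕ) : ℝ) + 1 = 2 * ((n : ℝ) + 1) := by push_cast; ring
    rw [nsmul_eq_mul, h2, Nat.add_sub_cancel]
    field_simp

/-- The inequality also covers dimension zero, where the sum is empty. -/
theorem sum_rmWeight_le_one (m : ℕ) : ∑ k ∈ Finset.Icc 1 m, rmWeight m k ≤ 1 := by
  rcases eq_or_ne m 0 with rfl | hm
  · simp
  · exact (sum_rmWeight hm).le

theorem Erm_eq {m : ℕ} {κ : Type*} [Fintype κ] (ψ : EuclideanSpace ℂ (Fin m × κ)) :
    Erm ψ = 1 - ∑ k ∈ Finset.Icc 1 m, rmWeight m k * moment ψ k := by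
  rcases Nat.even_or_odd m with ⟨n, rfl⟩ | ⟨n, rfl⟩
  · rw [Erm, if_pos ⟨n, rfl⟩, show (n + n) / 2 = n by omega, sum_rmWeight_even]
  · rw [Erm, if_neg (by simp), show (2 * n + 1 - 1) / 2 = n by omega,
      show (2 * n + 1 + 1) / 2 = n + 1 by omega, sum_rmWeight_odd]

end Weights

/-! ### Superadditive mixedness, bipartite monotonicity and faithfulness. -/

section Entropy

variable {ι κ : Type*} [Fintype ι] [DecidableEq ι] [Fintype κ]

/-- The mixedness `1 - ∑ k, rmWeight m k * Tr (A ^ k)` of a state, extended to positive matrices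
as a homogeneous function of degree one. -/
def mixedness (m : ℕ) (A : Matrix ι ι ℂ) : ℝ :=
  A.trace.re - ∑ k ∈ Finset.Icc 1 m, rmWeight m k * normMoment k A

theorem mixedness_nonneg (m : ℕ) {A : Matrix ι ι ℂ} (hA : A.PosSemidef) : 0 ≤ mixedness m A := by
  rw [mixedness, sub_nonneg]
  calc ∑ k ∈ Finset.Icc 1 m, rmWeight m k * normMoment k A
      ≤ ∑ k ∈ Finset.Icc 1 m, rmWeight m k * A.trace.re := by
        refine Finset.sum_le_sum fun k hk => mul_le_mul_of_nonneg_left ?_ (rmWeight_nonneg m k)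
        obtain ⟨l, rfl⟩ := Nat.exists_eq_add_of_le' (Finset.mem_Icc.1 hk).1
        exact normMoment_le_re_trace hA l
    _ ≤ A.trace.re := by
        rw [← Finset.sum_mul]
        exact mul_le_of_le_one_left (re_trace_nonneg hA) (sum_rmWeight_le_one m)

theorem sum_mixedness_le {n : Type*} [Fintype n] (m : ℕ) (A : n → Matrix ι ι ℂ)
    (hA : ∀ i, (A i).PosSemidef) : ∑ i, mixedness m (A i) ≤ mixedness m (∑ i, A i) := by
  unfold mixedness
  rw [Finset.sum_sub_distrib, Matrix.trace_sum, Complex.re_sum, Finset.sum_comm]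
  refine sub_le_sub_left (Finset.sum_le_sum fun k hk => ?_) _
  obtain ⟨l, rfl⟩ := Nat.exists_eq_add_of_le' (Finset.mem_Icc.1 hk).1
  rw [← Finset.mul_sum]
  exact mul_le_mul_of_nonneg_left (normMoment_sum_le l A hA) (rmWeight_nonneg _ _)

theorem mixedness_smul (m : ℕ) {r : ℝ} (hr : 0 ≤ r) (A : Matrix ι ι ℂ) :
    mixedness m (r • A) = r * mixedness m A := by
  unfold mixedness
  rw [Matrix.trace_smul, Complex.smul_re, smul_eq_mul, mul_sub, Finset.mul_sum]
  congr 1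
  refine Finset.sum_congr rfl fun k hk => ?_
  obtain ⟨l, rfl⟩ := Nat.exists_eq_add_of_le' (Finset.mem_Icc.1 hk).1
  rw [normMoment_smul l hr]
  ring

theorem mixedness_mul_comm [DecidableEq κ] (m : ℕ) (M : Matrix ι κ ℂ) (N : Matrix κ ι ℂ) :
    mixedness m (M * N) = mixedness m (N * M) := by
  unfold mixedness
  rw [Matrix.trace_mul_comm]
  congr 1
  refine Finset.sum_congr rfl fun k hk => ?_
  obtain ⟨l, rfl⟩ := Nat.exists_eq_add_of_le' (Finset.mem_Icc.1 hk).1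
  rw [normMoment_mul_comm]

/-- The entanglement of the bipartite vector with coefficient matrix `M`: the mixedness of the
reduced matrix. -/
def cutEnt (m : ℕ) (M : Matrix ι κ ℂ) : ℝ := mixedness m (M * Mᴴ)

theorem cutEnt_nonneg (m : ℕ) (M : Matrix ι κ ℂ) : 0 ≤ cutEnt m M :=
  mixedness_nonneg m (Matrix.posSemidef_self_mul_conjTranspose M)

theorem cutEnt_smul (m : ℕ) (z : ℂ) (M : Matrix ι κ ℂ) :
    cutEnt m (z • M) = Complex.normSq z * cutEnt m M := by
  unfold cutEnt
  rw [← mixedness_smul m (Complex.normSq_nonneg z)]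
  congr 1
  rw [Matrix.conjTranspose_smul, Matrix.smul_mul, Matrix.mul_smul, smul_smul]
  ext i j
  simp only [Matrix.smul_apply, smul_eq_mul, Complex.real_smul]
  rw [show z * star z = Complex.normSq z from Complex.mul_conj z]

/-- A measurement on the second factor splits the reduced matrix: the matrices `M * R i * (M * R
i)ᴴ` add up to `M * Mᴴ`, and `mixedness` is superadditive. -/
theorem sum_cutEnt_mul_right_le [DecidableEq κ] {n : Type*} [Fintype n] {μ : n → Type*} [∀ i, Fintype (μ i)]
    [∀ i, DecidableEq (μ i)] (m : ℕ) (M : Matrix ι κ ℂ)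
    (R : ∀ i, Matrix κ (μ i) ℂ) (hR : ∑ i, R i * (R i)ᴴ = 1) :
    ∑ i, cutEnt m (M * R i) ≤ cutEnt m M := by
  have h := sum_mixedness_le m (fun i => M * R i * (M * R i)ᴴ)
    fun i => Matrix.posSemidef_self_mul_conjTranspose _
  have hsum : ∑ i, M * R i * (M * R i)ᴴ = M * Mᴴ := by
    simp only [Matrix.conjTranspose_mul, Matrix.mul_assoc]
    rw [← Matrix.mul_sum]
    simp only [← Matrix.mul_assoc]
    rw [← Matrix.sum_mul, hR, Matrix.one_mul]
  rw [hsum] at h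
  exact h

/-- The reduced matrices of the two sides share their positive moments. The weight parameter `m` is
independent of the index type, so it stays the same. -/
theorem cutEnt_conjTranspose [DecidableEq κ] (m : ℕ) (M : Matrix ι κ ℂ) : cutEnt m Mᴴ = cutEnt m M := by
  unfold cutEnt
  rw [Matrix.conjTranspose_conjTranspose, mixedness_mul_comm]

theorem sum_cutEnt_mul_left_le [DecidableEq κ] {n : Type*} [Fintype n] {μ : n → Type*} [∀ i, Fintype (μ i)]
    [∀ i, DecidableEq (μ i)] (m : ℕ) (M : Matrix ι κ ℂ)
    (K : ∀ i, Matrix (μ i) ι ℂ) (hK : ∑ i, (K i)ᴴ * K i = 1) :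
    ∑ i, cutEnt m (K i * M) ≤ cutEnt m M := by
  have h := sum_cutEnt_mul_right_le m Mᴴ (fun i => (K i)ᴴ) (by simpa using hK)
  simpa only [← Matrix.conjTranspose_mul, cutEnt_conjTranspose] using h

/-- A Lagrange identity: the linear entropy of the reduced matrix is the total size of the 2×2
minors. -/
theorem sum_sum_normSq_minor (M : Matrix ι κ ℂ) :
    ∑ i, ∑ j, ∑ x, ∑ y, ((Complex.normSq (M i x * M j y - M i y * M j x) : ℝ) : ℂ)
      = 2 * ((M * Mᴴ).trace ^ 2 - ((M * Mᴴ) ^ 2).trace) := by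
  have hent : ∀ i j, (M * Mᴴ) i j = ∑ x, M i x * star (M j x) := fun i j => by
    simp [Matrix.mul_apply]
  have h1 : (M * Mᴴ).trace ^ 2
      = ∑ i, ∑ j, ∑ x, ∑ y, M i x * star (M i x) * (M j y * star (M j y)) := by
    rw [Matrix.trace, sq, Finset.sum_mul_sum]
    simp only [Matrix.diag_apply, hent, Finset.sum_mul_sum]
  have h2 : ((M * Mᴴ) ^ 2).trace
      = ∑ i, ∑ j, ∑ x, ∑ y, M i x * star (M j x) * (M j y * star (M i y)) := by
    rw [Matrix.trace, sq]
    simp only [Matrix.diag_apply, Matrix.mul_apply (M := M * Mᴴ), hent, Finset.sum_mul_sum]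
  -- Exchanging `x` and `y` supplies the other square and the other cross term in the expansion of
  -- the minor.
  have h1' : (M * Mᴴ).trace ^ 2
      = ∑ i, ∑ j, ∑ x, ∑ y, M i y * star (M i y) * (M j x * star (M j x)) := by
    rw [h1]
    exact Finset.sum_congr rfl fun i _ => Finset.sum_congr rfl fun j _ => Finset.sum_comm
  have h2' : ((M * Mᴴ) ^ 2).trace
      = ∑ i, ∑ j, ∑ x, ∑ y, M i y * star (M j y) * (M j x * star (M i x)) := by
    rw [h2]
    exact Finset.sum_congr rfl fun i _ => Finset.sum_congr rfl fun j _ => Finset.sum_comm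
  rw [two_mul]
  nth_rw 2 [h1']
  nth_rw 2 [h2']
  rw [h1, h2]
  simp only [← Finset.sum_sub_distrib, ← Finset.sum_add_distrib]
  refine Finset.sum_congr rfl fun i _ => Finset.sum_congr rfl fun j _ =>
    Finset.sum_congr rfl fun x _ => Finset.sum_congr rfl fun y _ => ?_
  rw [← Complex.mul_conj]
  simp only [map_sub, map_mul, Complex.star_def]
  ring

theorem exists_eq_mul_of_re_trace_sq {M : Matrix ι κ ℂ} (h1 : (M * Mᴴ).trace = 1)
    (h2 : ((M * Mᴴ) ^ 2).trace.re = 1) : ∃ (φ : ι → ℂ) (χ : κ → ℂ), ∀ i x, M i x = φ i * χ x := by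
  have hsum : ∑ i, ∑ j, ∑ x, ∑ y, Complex.normSq (M i x * M j y - M i y * M j x) = 0 := by
    have h := congrArg Complex.re (sum_sum_normSq_minor M)
    simp only [Complex.re_sum, Complex.ofReal_re, h1] at h
    rw [h]
    simp [h2]
  have hminor : ∀ i j x y, M i x * M j y = M i y * M j x := by
    intro i j x y
    have nn := fun i j x y => Complex.normSq_nonneg (M i x * M j y - M i y * M j x)
    have a1 := (Finset.sum_eq_zero_iff_of_nonneg fun i _ => Finset.sum_nonneg fun j _ =>
      Finset.sum_nonneg fun x _ => Finset.sum_nonneg fun y _ => nn i j x y).1 hsum i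
        (Finset.mem_univ i)
    have a2 := (Finset.sum_eq_zero_iff_of_nonneg fun j _ =>
      Finset.sum_nonneg fun x _ => Finset.sum_nonneg fun y _ => nn i j x y).1 a1 j
        (Finset.mem_univ j)
    have a3 := (Finset.sum_eq_zero_iff_of_nonneg fun x _ => Finset.sum_nonneg fun y _ =>
      nn i j x y).1 a2 x (Finset.mem_univ x)
    have a4 := (Finset.sum_eq_zero_iff_of_nonneg fun y _ => nn i j x y).1 a3 y (Finset.mem_univ y)
    exact sub_eq_zero.1 (Complex.normSq_eq_zero.1 a4)
  have hne : M ≠ 0 := by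
    rintro rfl
    simp at h1
  obtain ⟨j, y, hjy⟩ : ∃ j y, M j y ≠ 0 := by
    by_contra! hcon
    exact hne (by ext i x; exact hcon i x)
  -- With vanishing minors, the column and the row through a nonzero entry determine the matrix.
  refine ⟨fun i => M i y, fun x => M j x / M j y, fun i x => ?_⟩
  rw [← mul_div_assoc, ← hminor i j x y]
  field_simp

/-- The reduced matrix is idempotent of trace one, so all its positive moments equal one and the
weights add up to one. -/
theorem cutEnt_eq_zero_of_eq_mul {m : ℕ} (hm : m ≠ 0) {M : Matrix ι κ ℂ}
    (h1 : (M * Mᴴ).trace = 1) {φ : ι → ℂ} {χ : κ → ℂ} (hM : ∀ i x, M i x = φ i * χ x) :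
    cutEnt m M = 0 := by
  have hMv : M = Matrix.vecMulVec φ χ := by ext i x; exact hM i x
  have hid : M * Mᴴ * (M * Mᴴ) = M * Mᴴ := by
    rw [hMv] at h1 ⊢
    rw [Matrix.conjTranspose_vecMulVec, Matrix.vecMulVec_mul_vecMulVec, Matrix.vecMulVec_smul]
      at h1 ⊢
    rw [Matrix.trace_smul, Matrix.trace_vecMulVec, smul_eq_mul] at h1
    rw [Matrix.smul_mul, Matrix.mul_smul, Matrix.vecMulVec_mul_vecMulVec, Matrix.vecMulVec_smul,
      smul_smul, smul_smul, dotProduct_comm (star φ) φ, mul_assoc, h1, mul_one]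
  unfold cutEnt mixedness
  rw [Finset.sum_congr rfl fun k hk => ?_, sum_rmWeight hm]
  · simp [h1]
  · obtain ⟨l, rfl⟩ := Nat.exists_eq_add_of_le' (Finset.mem_Icc.1 hk).1
    have hpow : (M * Mᴴ) ^ (l + 1) = M * Mᴴ := IsIdempotentElem.pow_succ_eq l hid
    simp [normMoment, hpow, h1]

/-- The weighted moments are bounded termwise by the weights; equal totals force equality at `k =
2`, that is, purity one. -/
theorem exists_eq_mul_of_cutEnt_eq_zero {m : ℕ} (hm : 2 ≤ m) {M : Matrix ι κ ℂ}
    (h1 : (M * Mᴴ).trace = 1) (h : cutEnt m M = 0) :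
    ∃ (φ : ι → ℂ) (χ : κ → ℂ), ∀ i x, M i x = φ i * χ x := by
  have hpos := Matrix.posSemidef_self_mul_conjTranspose M
  refine exists_eq_mul_of_re_trace_sq h1 ?_
  have hle : ∀ k ∈ Finset.Icc 1 m, rmWeight m k * normMoment k (M * Mᴴ) ≤ rmWeight m k := by
    intro k hk
    obtain ⟨l, rfl⟩ := Nat.exists_eq_add_of_le' (Finset.mem_Icc.1 hk).1
    have := normMoment_le_re_trace hpos l
    rw [h1, Complex.one_re] at this
    exact mul_le_of_le_one_right (rmWeight_nonneg _ _) this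
  have hsum : ∑ k ∈ Finset.Icc 1 m, rmWeight m k * normMoment k (M * Mᴴ)
      = ∑ k ∈ Finset.Icc 1 m, rmWeight m k := by
    rw [sum_rmWeight (by omega)]
    unfold cutEnt mixedness at h
    rw [h1, Complex.one_re] at h
    linarith
  have h2 := (Finset.sum_eq_sum_iff_of_le hle).1 hsum 2 (Finset.mem_Icc.2 ⟨by omega, hm⟩)
  have h3 : normMoment 2 (M * Mᴴ) = 1 := by
    have := rmWeight_two_pos hm
    exact mul_left_cancel₀ this.ne' (h2.trans (mul_one _).symm)
  simpa [normMoment, h1] using h3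

end Entropy

/-! ### Compactness of convex hulls in finite dimension. -/

section Convex

/-- The convex hull of a compact set in a finite-dimensional space is compact. -/
theorem isCompact_convexHull {E : Type*} [AddCommGroup E] [Module ℝ E] [TopologicalSpace E]
    [IsTopologicalAddGroup E] [ContinuousSMul ℝ E] [FiniteDimensional ℝ E] {s : Set E}
    (hs : IsCompact s) : IsCompact (convexHull ℝ s) := by
  rcases s.eq_empty_or_nonempty with rfl | ⟨x₀, hx₀⟩
  · simp
  -- Carathéodory: `N` points suffice, so the hull is a continuous image of simplex times `s ^ N`.
  -- Shorter combinations are padded with weight zero at `x₀`.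
  let N := Module.finrank ℝ E + 1
  have hcomp : IsCompact ((fun q : (Fin N → ℝ) × (Fin N → E) => ∑ i, q.1 i • q.2 i) ''
      (stdSimplex ℝ (Fin N) ×ˢ Set.univ.pi fun _ => s)) :=
    ((isCompact_stdSimplex ℝ (Fin N)).prod (isCompact_univ_pi fun _ => hs)).image (by fun_prop)
  convert hcomp using 1
  refine Set.Subset.antisymm (fun x hx => ?_) ?_
  · obtain ⟨ι, _, z, w, hz, haff, hw, hw1, rfl⟩ := eq_pos_convex_span_of_mem_convexHull hx
    have hcard : Fintype.card ι ≤ Fintype.card (Fin N) := by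
      rw [Fintype.card_fin]
      exact haff.card_le_finrank_succ.trans (Nat.succ_le_succ (Submodule.finrank_le _))
    obtain ⟨e⟩ := Function.Embedding.nonempty_of_card_le hcard
    refine ⟨(Function.extend e w 0, Function.extend e z fun _ => x₀), ⟨⟨fun j => ?_, ?_⟩, ?_⟩, ?_⟩
    · by_cases hj : ∃ i, e i = j
      · obtain ⟨i, rfl⟩ := hj
        simp only [e.injective.extend_apply]
        exact (hw i).le
      · simp only [Function.extend_apply' _ _ _ hj]
        rfl
    · rw [← hw1]
      refine (Fintype.sum_of_injective e e.injective _ _ (fun j hj => ?_) fun i => ?_).symm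
      · simp only [Function.extend_apply' _ _ _ hj]
        rfl
      · simp only [e.injective.extend_apply]
    · intro j _
      by_cases hj : ∃ i, e i = j
      · obtain ⟨i, rfl⟩ := hj
        simp only [e.injective.extend_apply]
        exact hz (Set.mem_range_self i)
      · simp only [Function.extend_apply' _ _ _ hj]
        exact hx₀
    · refine (Fintype.sum_of_injective e e.injective _ _ (fun j hj => ?_) fun i => ?_).symm
      · simp only [Function.extend_apply' _ _ _ hj]
        exact zero_smul _ _
      · simp only [e.injective.extend_apply]
  · rintro _ ⟨⟨w, z⟩, ⟨hw, hz⟩, rfl⟩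
    exact mem_convexHull_of_exists_fintype w z hw.1 hw.2 (fun i => hz i (Set.mem_univ i)) rfl

end Convex

/-! ### Local operators on the three coefficient matrices, and pure-state monotonicity. -/

section Cuts

variable {a b c : ℕ}

/-- The coefficient matrix of `ψ` across `A|BC`. -/
def matA (ψ : Ket a b c) : Matrix (Fin a) (Fin b × Fin c) ℂ := Matrix.of fun i x => ψ (i, x.1, x.2)

/-- The coefficient matrix of `ψ` across `B|AC`. -/
def matB (ψ : Ket a b c) : Matrix (Fin b) (Fin a × Fin c) ℂ := Matrix.of fun i x => ψ (x.1, i, x.2)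

/-- The coefficient matrix of `ψ` across `C|AB`. -/
def matC (ψ : Ket a b c) : Matrix (Fin c) (Fin a × Fin b) ℂ := Matrix.of fun i x => ψ (x.1, x.2, i)

/-- The vector `T ψ`. -/
def app {ι κ : Type*} [Fintype ι] (T : Matrix κ ι ℂ) (ψ : EuclideanSpace ℂ ι) :
    EuclideanSpace ℂ κ :=
  WithLp.toLp 2 (T *ᵥ ψ.ofLp)

theorem conj_ketbra {ι κ : Type*} [Fintype ι] (T : Matrix κ ι ℂ) (ψ : EuclideanSpace ℂ ι) :
    conj T (ketbra ψ) = ketbra (app T ψ) := by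
  change T * vecMulVec ψ.ofLp (star ψ.ofLp) * Tᴴ = vecMulVec (T *ᵥ ψ.ofLp) (star (T *ᵥ ψ.ofLp))
  rw [Matrix.mul_vecMulVec, Matrix.vecMulVec_mul, Matrix.star_mulVec]

theorem app_localOp_left {r : ℕ} (K : Matrix (Fin r) (Fin a) ℂ) (ψ : Ket a b c) (i j k) :
    app (localOp K 1 1) ψ (i, j, k) = ∑ l, K i l * ψ (l, j, k) := by
  simp [app, localOp, Matrix.mulVec, dotProduct, Fintype.sum_prod_type, Matrix.one_apply]

theorem app_localOp_mid {r : ℕ} (K : Matrix (Fin r) (Fin b) ℂ) (ψ : Ket a b c) (i j k) :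
    app (localOp 1 K 1) ψ (i, j, k) = ∑ l, K j l * ψ (i, l, k) := by
  simp [app, localOp, Matrix.mulVec, dotProduct, Fintype.sum_prod_type, Matrix.one_apply]

theorem app_localOp_right {r : ℕ} (K : Matrix (Fin r) (Fin c) ℂ) (ψ : Ket a b c) (i j k) :
    app (localOp 1 1 K) ψ (i, j, k) = ∑ l, K k l * ψ (i, j, l) := by
  simp [app, localOp, Matrix.mulVec, dotProduct, Fintype.sum_prod_type, Matrix.one_apply]

theorem matA_app_left {r : ℕ} (K : Matrix (Fin r) (Fin a) ℂ) (ψ : Ket a b c) :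
    matA (app (localOp K 1 1) ψ) = K * matA ψ := by
  ext i ⟨j, k⟩
  simp [matA, app_localOp_left, Matrix.mul_apply]

/-- Operators of the other parties act on the column index, hence from the right and transposed. -/
theorem matB_app_left {r : ℕ} (K : Matrix (Fin r) (Fin a) ℂ) (ψ : Ket a b c) :
    matB (app (localOp K 1 1) ψ) = matB ψ * (K ⊗ₖ (1 : Matrix (Fin c) (Fin c) ℂ))ᵀ := by
  ext j ⟨i, k⟩
  simp [matB, app_localOp_left, Matrix.mul_apply, Fintype.sum_prod_type, Matrix.one_apply, mul_comm]

theorem matC_app_left {r : ℕ} (K : Matrix (Fin r) (Fin a) ℂ) (ψ : Ket a b c) :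
    matC (app (localOp K 1 1) ψ) = matC ψ * (K ⊗ₖ (1 : Matrix (Fin b) (Fin b) ℂ))ᵀ := by
  ext k ⟨i, j⟩
  simp [matC, app_localOp_left, Matrix.mul_apply, Fintype.sum_prod_type, Matrix.one_apply, mul_comm]

theorem matA_app_mid {r : ℕ} (K : Matrix (Fin r) (Fin b) ℂ) (ψ : Ket a b c) :
    matA (app (localOp 1 K 1) ψ) = matA ψ * (K ⊗ₖ (1 : Matrix (Fin c) (Fin c) ℂ))ᵀ := by
  ext i ⟨j, k⟩
  simp [matA, app_localOp_mid, Matrix.mul_apply, Fintype.sum_prod_type, Matrix.one_apply, mul_comm]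

theorem matB_app_mid {r : ℕ} (K : Matrix (Fin r) (Fin b) ℂ) (ψ : Ket a b c) :
    matB (app (localOp 1 K 1) ψ) = K * matB ψ := by
  ext j ⟨i, k⟩
  simp [matB, app_localOp_mid, Matrix.mul_apply]

theorem matC_app_mid {r : ℕ} (K : Matrix (Fin r) (Fin b) ℂ) (ψ : Ket a b c) :
    matC (app (localOp 1 K 1) ψ) = matC ψ * ((1 : Matrix (Fin a) (Fin a) ℂ) ⊗ₖ K)ᵀ := by
  ext k ⟨i, j⟩
  simp [matC, app_localOp_mid, Matrix.mul_apply, Fintype.sum_prod_type, Matrix.one_apply, mul_comm]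

theorem matA_app_right {r : ℕ} (K : Matrix (Fin r) (Fin c) ℂ) (ψ : Ket a b c) :
    matA (app (localOp 1 1 K) ψ) = matA ψ * ((1 : Matrix (Fin b) (Fin b) ℂ) ⊗ₖ K)ᵀ := by
  ext i ⟨j, k⟩
  simp [matA, app_localOp_right, Matrix.mul_apply, Fintype.sum_prod_type, Matrix.one_apply,
    mul_comm]

theorem matB_app_right {r : ℕ} (K : Matrix (Fin r) (Fin c) ℂ) (ψ : Ket a b c) :
    matB (app (localOp 1 1 K) ψ) = matB ψ * ((1 : Matrix (Fin a) (Fin a) ℂ) ⊗ₖ K)ᵀ := by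
  ext j ⟨i, k⟩
  simp [matB, app_localOp_right, Matrix.mul_apply, Fintype.sum_prod_type, Matrix.one_apply,
    mul_comm]

theorem matC_app_right {r : ℕ} (K : Matrix (Fin r) (Fin c) ℂ) (ψ : Ket a b c) :
    matC (app (localOp 1 1 K) ψ) = K * matC ψ := by
  ext k ⟨i, j⟩
  simp [matC, app_localOp_right, Matrix.mul_apply]

section Kraus

variable {n ι κ : Type*} [Fintype n] {μ : n → Type*} [∀ i, Fintype (μ i)]
  [DecidableEq ι] [Fintype κ] [DecidableEq κ]

theorem sum_transpose_mul_of_kraus (T : ∀ i, Matrix (μ i) ι ℂ) (hT : ∑ i, (T i)ᴴ * T i = 1) :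
    ∑ i, (T i)ᵀ * ((T i)ᵀ)ᴴ = 1 := by
  have h := congrArg Matrix.transpose hT
  rw [Matrix.transpose_sum, Matrix.transpose_one] at h
  rw [← h]
  refine Finset.sum_congr rfl fun i _ => ?_
  rw [Matrix.transpose_mul]
  rfl

theorem sum_kronecker_one_of_kraus (T : ∀ i, Matrix (μ i) ι ℂ) (hT : ∑ i, (T i)ᴴ * T i = 1) :
    ∑ i, (T i ⊗ₖ (1 : Matrix κ κ ℂ))ᴴ * (T i ⊗ₖ (1 : Matrix κ κ ℂ)) = 1 := by
  have h : ∀ i, (T i ⊗ₖ (1 : Matrix κ κ ℂ))ᴴ * (T i ⊗ₖ (1 : Matrix κ κ ℂ))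
      = ((T i)ᴴ * T i) ⊗ₖ (1 : Matrix κ κ ℂ) := fun i => by
    rw [Matrix.conjTranspose_kronecker, ← Matrix.mul_kronecker_mul, Matrix.conjTranspose_one,
      Matrix.one_mul]
  simp only [h]
  rw [← Matrix.one_kronecker_one, ← hT]
  ext ⟨i, j⟩ ⟨i', j'⟩
  simp [Matrix.sum_apply, Finset.sum_mul]

theorem sum_one_kronecker_of_kraus (T : ∀ i, Matrix (μ i) ι ℂ) (hT : ∑ i, (T i)ᴴ * T i = 1) :
    ∑ i, ((1 : Matrix κ κ ℂ) ⊗ₖ T i)ᴴ * ((1 : Matrix κ κ ℂ) ⊗ₖ T i) = 1 := by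
  have h : ∀ i, ((1 : Matrix κ κ ℂ) ⊗ₖ T i)ᴴ * ((1 : Matrix κ κ ℂ) ⊗ₖ T i)
      = (1 : Matrix κ κ ℂ) ⊗ₖ ((T i)ᴴ * T i) := fun i => by
    rw [Matrix.conjTranspose_kronecker, ← Matrix.mul_kronecker_mul, Matrix.conjTranspose_one,
      Matrix.one_mul]
  simp only [h]
  rw [← Matrix.one_kronecker_one, ← hT]
  ext ⟨i, j⟩ ⟨i', j'⟩
  simp [Matrix.sum_apply, Finset.mul_sum]

end Kraus

/-- `EgtePure` with the moment weights of the dimensions `a'`, `b'`, `c'`, extended to a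
homogeneous function of degree two. -/
def homEgte (a' b' c' : ℕ) (ψ : Ket a b c) : ℝ :=
  (cutEnt a' (matA ψ) * cutEnt b' (matB ψ) * cutEnt c' (matC ψ)) ^ (1 / 3 : ℝ)

theorem homEgte_nonneg (a' b' c' : ℕ) (ψ : Ket a b c) : 0 ≤ homEgte a' b' c' ψ :=
  Real.rpow_nonneg (mul_nonneg (mul_nonneg (cutEnt_nonneg _ _) (cutEnt_nonneg _ _))
    (cutEnt_nonneg _ _)) _

theorem homEgte_smul (a' b' c' : ℕ) (z : ℂ) (ψ : Ket a b c) :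
    homEgte a' b' c' (z • ψ) = Complex.normSq z * homEgte a' b' c' ψ := by
  have hA : matA (z • ψ) = z • matA ψ := by ext; simp [matA]
  have hB : matB (z • ψ) = z • matB ψ := by ext; simp [matB]
  have hC : matC (z • ψ) = z • matC ψ := by ext; simp [matC]
  have hz := Complex.normSq_nonneg z
  unfold homEgte
  rw [hA, hB, hC, cutEnt_smul, cutEnt_smul, cutEnt_smul]
  have hnn := mul_nonneg (mul_nonneg (cutEnt_nonneg a' (matA ψ)) (cutEnt_nonneg b' (matB ψ)))
    (cutEnt_nonneg c' (matC ψ))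
  rw [show ∀ r x y w : ℝ, r * x * (r * y) * (r * w) = r ^ 3 * (x * y * w) by intros; ring,
    Real.mul_rpow (by positivity) hnn]
  congr 1
  rw [← Real.rpow_natCast, ← Real.rpow_mul hz]
  norm_num

/-- Hölder bounds the sum of geometric means by the geometric mean of the sums, so it suffices to
control each cut separately. -/
theorem sum_homEgte_le {n : ℕ} (a' b' c' : ℕ) (ψ : Ket a b c) {ra rb rc : Fin n → ℕ}
    (φ : ∀ i, Ket (ra i) (rb i) (rc i))
    (hA : ∑ i, cutEnt a' (matA (φ i)) ≤ cutEnt a' (matA ψ))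
    (hB : ∑ i, cutEnt b' (matB (φ i)) ≤ cutEnt b' (matB ψ))
    (hC : ∑ i, cutEnt c' (matC (φ i)) ≤ cutEnt c' (matC ψ)) :
    ∑ i, homEgte a' b' c' (φ i) ≤ homEgte a' b' c' ψ := by
  refine (sum_geom_mean_le _ _ _ (fun i => cutEnt_nonneg a' (matA (φ i)))
    (fun i => cutEnt_nonneg b' (matB (φ i))) fun i => cutEnt_nonneg c' (matC (φ i))).trans ?_
  have nA := Finset.sum_nonneg fun i (_ : i ∈ Finset.univ) => cutEnt_nonneg a' (matA (φ i))
  have nB := Finset.sum_nonneg fun i (_ : i ∈ Finset.univ) => cutEnt_nonneg b' (matB (φ i))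
  have nC := Finset.sum_nonneg fun i (_ : i ∈ Finset.univ) => cutEnt_nonneg c' (matC (φ i))
  refine Real.rpow_le_rpow (mul_nonneg (mul_nonneg nA nB) nC) ?_ (by norm_num)
  exact mul_le_mul (mul_le_mul hA hB nB (nA.trans hA)) hC nC
    (mul_nonneg (nA.trans hA) (nB.trans hB))

variable {n : ℕ} {r : Fin n → ℕ} (a' b' c' : ℕ) (ψ : Ket a b c)

theorem sum_homEgte_left_le (K : ∀ i, Matrix (Fin (r i)) (Fin a) ℂ)
    (hK : ∑ i, (K i)ᴴ * K i = 1) :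
    ∑ i, homEgte a' b' c'
      (app (localOp (K i) (1 : Matrix (Fin b) (Fin b) ℂ) (1 : Matrix (Fin c) (Fin c) ℂ)) ψ)
      ≤ homEgte a' b' c' ψ := by
  refine sum_homEgte_le a' b' c' ψ _ ?_ ?_ ?_
  · simp only [matA_app_left]
    exact sum_cutEnt_mul_left_le _ _ _ hK
  · simp only [matB_app_left]
    exact sum_cutEnt_mul_right_le _ _ _
      (sum_transpose_mul_of_kraus _ (sum_kronecker_one_of_kraus _ hK))
  · simp only [matC_app_left]
    exact sum_cutEnt_mul_right_le _ _ _
      (sum_transpose_mul_of_kraus _ (sum_kronecker_one_of_kraus _ hK))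

theorem sum_homEgte_mid_le (K : ∀ i, Matrix (Fin (r i)) (Fin b) ℂ)
    (hK : ∑ i, (K i)ᴴ * K i = 1) :
    ∑ i, homEgte a' b' c'
      (app (localOp (1 : Matrix (Fin a) (Fin a) ℂ) (K i) (1 : Matrix (Fin c) (Fin c) ℂ)) ψ)
      ≤ homEgte a' b' c' ψ := by
  refine sum_homEgte_le a' b' c' ψ _ ?_ ?_ ?_
  · simp only [matA_app_mid]
    exact sum_cutEnt_mul_right_le _ _ _
      (sum_transpose_mul_of_kraus _ (sum_kronecker_one_of_kraus _ hK))
  · simp only [matB_app_mid]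
    exact sum_cutEnt_mul_left_le _ _ _ hK
  · simp only [matC_app_mid]
    exact sum_cutEnt_mul_right_le _ _ _
      (sum_transpose_mul_of_kraus _ (sum_one_kronecker_of_kraus _ hK))

theorem sum_homEgte_right_le (K : ∀ i, Matrix (Fin (r i)) (Fin c) ℂ)
    (hK : ∑ i, (K i)ᴴ * K i = 1) :
    ∑ i, homEgte a' b' c'
      (app (localOp (1 : Matrix (Fin a) (Fin a) ℂ) (1 : Matrix (Fin b) (Fin b) ℂ) (K i)) ψ) ≤ homEgte a' b' c' ψ := by
  refine sum_homEgte_le a' b' c' ψ _ ?_ ?_ ?_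
  · simp only [matA_app_right]
    exact sum_cutEnt_mul_right_le _ _ _
      (sum_transpose_mul_of_kraus _ (sum_one_kronecker_of_kraus _ hK))
  · simp only [matB_app_right]
    exact sum_cutEnt_mul_right_le _ _ _
      (sum_transpose_mul_of_kraus _ (sum_one_kronecker_of_kraus _ hK))
  · simp only [matC_app_right]
    exact sum_cutEnt_mul_left_le _ _ _ hK

end Cuts

/-! ### Rank-one operators and rigidity of decompositions of a pure state. -/

section Ketbra

variable {ι : Type*}

theorem ketbra_smul (z : ℂ) (ψ : EuclideanSpace ℂ ι) :
    ketbra (z • ψ) = Complex.normSq z • ketbra ψ := by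
  ext x y
  simp only [ketbra, Matrix.of_apply, Matrix.smul_apply, PiLp.smul_apply, smul_eq_mul,
    Complex.real_smul, star_mul']
  rw [← Complex.mul_conj, Complex.star_def]
  ring

variable [Fintype ι]

theorem sum_mul_star_eq (ψ : EuclideanSpace ℂ ι) :
    ∑ x, ψ x * star (ψ x) = ((‖ψ‖ ^ 2 : ℝ) : ℂ) := by
  rw [EuclideanSpace.norm_sq_eq, Complex.ofReal_sum]
  refine Finset.sum_congr rfl fun x _ => ?_
  rw [← Complex.normSq_eq_norm_sq, ← Complex.mul_conj, Complex.star_def]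

theorem trace_ketbra (ψ : EuclideanSpace ℂ ι) : (ketbra ψ).trace = ((‖ψ‖ ^ 2 : ℝ) : ℂ) :=
  sum_mul_star_eq ψ

theorem posSemidef_ketbra (ψ : EuclideanSpace ℂ ι) : (ketbra ψ).PosSemidef :=
  Matrix.posSemidef_vecMulVec_self_star ψ.ofLp

theorem dotProduct_ketbra_mulVec (φ ψ : EuclideanSpace ℂ ι) :
    (star φ.ofLp ⬝ᵥ (ketbra ψ *ᵥ φ.ofLp)).re = Complex.normSq (inner ℂ φ ψ) := by
  change (star φ.ofLp ⬝ᵥ (vecMulVec ψ.ofLp (star ψ.ofLp) *ᵥ φ.ofLp)).re = _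
  have h : star φ.ofLp ⬝ᵥ (vecMulVec ψ.ofLp (star ψ.ofLp) *ᵥ φ.ofLp)
      = inner ℂ φ ψ * inner ℂ ψ φ := by
    rw [Matrix.vecMulVec_mulVec, EuclideanSpace.inner_eq_star_dotProduct,
      EuclideanSpace.inner_eq_star_dotProduct, dotProduct_comm (star φ.ofLp) _]
    simp only [smul_dotProduct, MulOpposite.smul_eq_mul_unop, MulOpposite.unop_op,
      dotProduct_comm (star ψ.ofLp)]
  rw [h, ← inner_conj_symm ψ φ, Complex.mul_conj, Complex.ofReal_re]

/-- The vectors of a pure state decomposition of a pure state are multiples of its vector. -/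
theorem IsPureDecomposition.exists_eq_smul {ψ : EuclideanSpace ℂ ι} (hψ : ‖ψ‖ = 1) {n : ℕ}
    {p : Fin n → ℝ} {φ : Fin n → EuclideanSpace ℂ ι} (h : IsPureDecomposition (ketbra ψ) p φ)
    {i : Fin n} (hi : p i ≠ 0) : ∃ z : ℂ, Complex.normSq z = 1 ∧ φ i = z • ψ := by
  set z : ℂ := inner ℂ ψ (φ i) with hz
  set χ := φ i - z • ψ with hχ
  have hχψ : inner ℂ χ ψ = 0 := by
    rw [hχ, inner_sub_left, inner_smul_left, hz, inner_conj_symm, inner_self_eq_norm_sq_to_K, hψ]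
    simp
  -- The expectation of the pure state in `χ ⟂ ψ` is zero, and the decomposition writes it as a sum
  -- of nonnegative terms.
  have hsum : ∑ j, p j * Complex.normSq (inner ℂ χ (φ j)) = 0 := by
    have h1 := dotProduct_ketbra_mulVec χ ψ
    rw [h.eq_sum, hχψ, map_zero, Matrix.sum_mulVec, dotProduct_sum, Complex.re_sum] at h1
    rw [← h1]
    refine Finset.sum_congr rfl fun j _ => ?_
    rw [Matrix.smul_mulVec, dotProduct_smul, Complex.smul_re, dotProduct_ketbra_mulVec, smul_eq_mul]
  have h2 := (Finset.sum_eq_zero_iff_of_nonneg fun j _ =>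
    mul_nonneg (h.nonneg j) (Complex.normSq_nonneg _)).1 hsum i (Finset.mem_univ i)
  have h3 : inner ℂ χ (φ i) = 0 := Complex.normSq_eq_zero.1 ((mul_eq_zero.1 h2).resolve_left hi)
  have h4 : χ = 0 := by
    rw [← inner_self_eq_zero (𝕜 := ℂ)]
    nth_rw 2 [hχ]
    rw [inner_sub_right, inner_smul_right, h3, hχψ]
    simp
  have h5 : φ i = z • ψ := sub_eq_zero.1 h4
  refine ⟨z, ?_, h5⟩
  have h6 := h.norm_eq_one i
  rw [h5, norm_smul, hψ, mul_one] at h6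
  rw [Complex.normSq_eq_norm_sq, h6, one_pow]

end Ketbra

/-! ### The measure on unit vectors: homogeneous form, continuity and zeros. -/

section PureStates

variable {a b c : ℕ}

theorem reduced_cutA (ψ : Ket a b c) : reduced (cutA ψ) = matA ψ * (matA ψ)ᴴ := rfl

theorem reduced_cutB (ψ : Ket a b c) : reduced (cutB ψ) = matB ψ * (matB ψ)ᴴ := rfl

theorem reduced_cutC (ψ : Ket a b c) : reduced (cutC ψ) = matC ψ * (matC ψ)ᴴ := rfl

theorem trace_reduced_cutA (ψ : Ket a b c) : (reduced (cutA ψ)).trace = ((‖ψ‖ ^ 2 : ℝ) : ℂ) := by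
  rw [← sum_mul_star_eq]
  simp [reduced, cutA, Matrix.trace, Fintype.sum_prod_type]

theorem trace_reduced_cutB (ψ : Ket a b c) : (reduced (cutB ψ)).trace = ((‖ψ‖ ^ 2 : ℝ) : ℂ) := by
  rw [← sum_mul_star_eq]
  simp only [reduced, cutB, Matrix.trace, Fintype.sum_prod_type, Matrix.diag_apply,
    Matrix.of_apply]
  rw [Finset.sum_comm]

theorem trace_reduced_cutC (ψ : Ket a b c) : (reduced (cutC ψ)).trace = ((‖ψ‖ ^ 2 : ℝ) : ℂ) := by
  rw [← sum_mul_star_eq]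
  simp only [reduced, cutC, Matrix.trace, Fintype.sum_prod_type, Matrix.diag_apply,
    Matrix.of_apply]
  rw [Finset.sum_comm]
  exact Finset.sum_congr rfl fun i _ => Finset.sum_comm

theorem Erm_eq_mixedness {m : ℕ} {κ : Type*} [Fintype κ] (ψ : EuclideanSpace ℂ (Fin m × κ))
    (h : (reduced ψ).trace = 1) : Erm ψ = mixedness m (reduced ψ) := by
  simp [Erm_eq, mixedness, normMoment, moment, h]

theorem EgtePure_eq_homEgte {ψ : Ket a b c} (hψ : ‖ψ‖ = 1) : EgtePure ψ = homEgte a b c ψ := by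
  unfold EgtePure homEgte
  rw [Erm_eq_mixedness, Erm_eq_mixedness, Erm_eq_mixedness]
  · rfl
  · rw [trace_reduced_cutC, hψ]; simp
  · rw [trace_reduced_cutB, hψ]; simp
  · rw [trace_reduced_cutA, hψ]; simp

theorem EgtePure_nonneg {ψ : Ket a b c} (hψ : ‖ψ‖ = 1) : 0 ≤ EgtePure ψ := by
  rw [EgtePure_eq_homEgte hψ]
  exact homEgte_nonneg _ _ _ _

theorem continuous_Erm {X : Type*} [TopologicalSpace X] {m : ℕ} {κ : Type*} [Fintype κ]
    {f : X → EuclideanSpace ℂ (Fin m × κ)} (hf : Continuous f) : Continuous fun x => Erm (f x) := by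
  have hred : Continuous fun x => reduced (f x) := by
    refine continuous_matrix fun i j => ?_
    simp only [reduced, Matrix.of_apply]
    fun_prop
  simp only [Erm_eq, moment]
  refine continuous_const.sub (continuous_finsetSum _ fun k _ => continuous_const.mul ?_)
  exact Complex.continuous_re.comp (hred.pow k).matrix_trace

theorem continuous_EgtePure : Continuous (EgtePure : Ket a b c → ℝ) := by
  unfold EgtePure
  refine Continuous.rpow_const (((continuous_Erm ?_).mul (continuous_Erm ?_)).mul
    (continuous_Erm ?_)) fun _ => Or.inr (by norm_num)
  · unfold cutA; fun_prop
  · unfold cutB; fun_prop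
  · unfold cutC; fun_prop

theorem cutEnt_eq_zero_iff {m : ℕ} {κ : Type*} [Fintype κ] {M : Matrix (Fin m) κ ℂ}
    (h1 : (M * Mᴴ).trace = 1) :
    cutEnt m M = 0 ↔ ∃ (φ : EuclideanSpace ℂ (Fin m)) (χ : EuclideanSpace ℂ κ),
      ∀ i x, M i x = φ i * χ x := by
  constructor
  · intro h
    -- Below dimension two there is no second moment to use, but every vector is a product.
    rcases lt_or_ge m 2 with hm | hm
    · interval_cases m
      · exact ⟨0, 0, fun i => i.elim0⟩
      · exact ⟨WithLp.toLp 2 fun _ => 1, WithLp.toLp 2 fun x => M 0 x, fun i x => by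
          rw [Subsingleton.elim i 0]; simp⟩
    · obtain ⟨φ, χ, hM⟩ := exists_eq_mul_of_cutEnt_eq_zero hm h1 h
      exact ⟨WithLp.toLp 2 φ, WithLp.toLp 2 χ, hM⟩
  · rintro ⟨φ, χ, hM⟩
    refine cutEnt_eq_zero_of_eq_mul ?_ h1 hM
    rintro rfl
    simp [Matrix.trace] at h1

theorem EgtePure_eq_zero_iff {ψ : Ket a b c} (hψ : ‖ψ‖ = 1) :
    EgtePure ψ = 0 ↔ IsBiseparablePure ψ := by
  have hA : cutEnt a (matA ψ) = 0 ↔ IsProduct (cutA ψ) := cutEnt_eq_zero_iff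
    (by rw [← reduced_cutA, trace_reduced_cutA, hψ]; simp)
  have hB : cutEnt b (matB ψ) = 0 ↔ IsProduct (cutB ψ) := cutEnt_eq_zero_iff
    (by rw [← reduced_cutB, trace_reduced_cutB, hψ]; simp)
  have hC : cutEnt c (matC ψ) = 0 ↔ IsProduct (cutC ψ) := cutEnt_eq_zero_iff
    (by rw [← reduced_cutC, trace_reduced_cutC, hψ]; simp)
  rw [EgtePure_eq_homEgte hψ, homEgte, Real.rpow_eq_zero
    (mul_nonneg (mul_nonneg (cutEnt_nonneg _ _) (cutEnt_nonneg _ _)) (cutEnt_nonneg _ _))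
    (by norm_num), mul_eq_zero, mul_eq_zero, hA, hB, hC, or_assoc]
  rfl

end PureStates

/-! ### The convex roof as the lower boundary of the hull of the graph. -/

section Roof

variable {a b c : ℕ}

variable (a b c) in
/-- The pairs of a pure state and its value. -/
def pureGraph : Set (Op a b c × ℝ) :=
  (fun ψ : Ket a b c => (ketbra ψ, EgtePure ψ)) '' Metric.sphere 0 1

theorem mem_pureGraph {ψ : Ket a b c} (hψ : ‖ψ‖ = 1) : (ketbra ψ, EgtePure ψ) ∈ pureGraph a b c :=
  ⟨ψ, by simpa using hψ, rfl⟩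

theorem isCompact_pureGraph : IsCompact (pureGraph a b c) := by
  refine (isCompact_sphere 0 1).image (Continuous.prodMk ?_ continuous_EgtePure)
  refine continuous_matrix fun x y => ?_
  simp only [ketbra, Matrix.of_apply]
  fun_prop

theorem mem_roofValues_iff {ρ : Op a b c} {v : ℝ} :
    v ∈ roofValues ρ ↔ (ρ, v) ∈ convexHull ℝ (pureGraph a b c) := by
  constructor
  · rintro ⟨n, p, ψ, h, rfl⟩
    refine mem_convexHull_of_exists_fintype p (fun i => (ketbra (ψ i), EgtePure (ψ i))) h.nonneg
      h.sum_eq_one (fun i => mem_pureGraph (h.norm_eq_one i)) ?_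
    ext1
    · simp [Prod.fst_sum, h.eq_sum]
    · simp [Prod.snd_sum]
  · intro h
    obtain ⟨ι, _, w, z, hw, hw1, hz, hsum⟩ := mem_convexHull_iff_exists_fintype.1 h
    choose ψ hψ hψz using hz
    let e := (Fintype.equivFin ι).symm
    have hsum' : ∑ i, w (e i) • z (e i) = (ρ, v) := by
      rw [← hsum]
      exact e.sum_comp fun i => w i • z i
    refine ⟨Fintype.card ι, w ∘ e, ψ ∘ e, ⟨fun i => hw _, ?_, fun i => ?_, ?_⟩, ?_⟩
    · rw [← hw1]
      exact e.sum_comp w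
    · simpa using hψ (e i)
    · have := congrArg Prod.fst hsum'
      simp only [← hψz, Prod.fst_sum, Prod.smul_fst] at this
      exact this.symm
    · have := congrArg Prod.snd hsum'
      simp only [← hψz, Prod.snd_sum, Prod.smul_snd, smul_eq_mul] at this
      exact this.symm

theorem mem_hull_pureGraph {q : Op a b c × ℝ} (hq : q ∈ convexHull ℝ (pureGraph a b c)) :
    IsState q.1 ∧ 0 ≤ q.2 := by
  obtain ⟨n, p, ψ, h, hv⟩ := mem_roofValues_iff.2 hq
  refine ⟨⟨?_, ?_⟩, ?_⟩
  · rw [h.eq_sum]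
    exact Matrix.posSemidef_sum _ fun i _ => (posSemidef_ketbra _).smul (h.nonneg i)
  · rw [h.eq_sum, Matrix.trace_sum]
    simp only [Matrix.trace_smul, trace_ketbra, h.norm_eq_one]
    have := congrArg (fun x : ℝ => (x : ℂ)) h.sum_eq_one
    simpa using this
  · rw [hv]
    exact Finset.sum_nonneg fun i _ => mul_nonneg (h.nonneg i) (EgtePure_nonneg (h.norm_eq_one i))

/-- The spectral decomposition is a pure state decomposition; its vectors `u i` are the columns of
the diagonalizing unitary. -/
theorem exists_mem_hull_pureGraph {ρ : Op a b c} (hρ : IsState ρ) :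
    ∃ v, (ρ, v) ∈ convexHull ℝ (pureGraph a b c) := by
  obtain ⟨U, d, hd, h⟩ := exists_unitary_diagonal_eq hρ.1
  have hU := U.2
  rw [Matrix.mem_unitaryGroup_iff'] at hU
  let u : Idx a b c → Ket a b c := fun i => WithLp.toLp 2 fun x => (U : Op a b c) x i
  have hu : ∀ i, ‖u i‖ = 1 := by
    intro i
    have h1 := sum_mul_star_eq (u i)
    have h2 := congrFun (congrFun hU i) i
    rw [Matrix.mul_apply, Matrix.one_apply_eq] at h2
    have h3 : ((‖u i‖ ^ 2 : ℝ) : ℂ) = ((1 : ℝ) : ℂ) := by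
      rw [← h1, Complex.ofReal_one, ← h2]
      exact Finset.sum_congr rfl fun x _ => mul_comm _ _
    exact (pow_eq_one_iff_of_nonneg (norm_nonneg _) two_ne_zero).1
      (Complex.ofReal_injective h3)
  have hsum : ∑ i, d i • ketbra (u i) = ρ := by
    have h1 := h 1
    rw [pow_one] at h1
    rw [h1]
    ext x y
    rw [Matrix.mul_apply, Matrix.sum_apply]
    refine Finset.sum_congr rfl fun i _ => ?_
    rw [Matrix.mul_diagonal]
    simp only [ketbra, u, Matrix.smul_apply, Matrix.of_apply, Complex.real_smul, Matrix.star_apply,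
      pow_one]
    ring
  have hd1 : ∑ i, d i = 1 := by
    have h1 := hρ.2
    rw [← hsum, Matrix.trace_sum] at h1
    simp only [Matrix.trace_smul, trace_ketbra, hu] at h1
    simp only [one_pow, Complex.ofReal_one, Complex.real_smul, mul_one] at h1
    exact_mod_cast h1
  refine ⟨∑ i, d i * EgtePure (u i), mem_convexHull_of_exists_fintype d
    (fun i => (ketbra (u i), EgtePure (u i))) hd hd1 (fun i => mem_pureGraph (hu i)) ?_⟩
  ext1
  · simp [Prod.fst_sum, hsum]
  · simp [Prod.snd_sum]

/-- The fibre of the compact hull over `ρ` is compact and nonempty, so its height attains its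
infimum. -/
theorem isLeast_Egte {ρ : Op a b c} (hρ : IsState ρ) : IsLeast (roofValues ρ) (Egte ρ) := by
  have hset : roofValues ρ = Prod.snd '' (convexHull ℝ (pureGraph a b c) ∩ {q | q.1 = ρ}) := by
    ext v
    rw [mem_roofValues_iff]
    constructor
    · exact fun h => ⟨(ρ, v), ⟨h, rfl⟩, rfl⟩
    · rintro ⟨⟨σ, w⟩, ⟨h, rfl⟩, rfl⟩
      exact h
  have hcomp : IsCompact (roofValues ρ) := by
    rw [hset]
    exact ((isCompact_convexHull isCompact_pureGraph).inter_right
      (isClosed_eq continuous_fst continuous_const)).image continuous_snd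
  obtain ⟨v, hv⟩ := exists_mem_hull_pureGraph hρ
  exact hcomp.isLeast_sInf ⟨v, mem_roofValues_iff.2 hv⟩

theorem mk_Egte_mem_hull {ρ : Op a b c} (hρ : IsState ρ) :
    (ρ, Egte ρ) ∈ convexHull ℝ (pureGraph a b c) :=
  mem_roofValues_iff.1 (isLeast_Egte hρ).1

theorem Egte_le_of_mem_hull {q : Op a b c × ℝ} (hq : q ∈ convexHull ℝ (pureGraph a b c)) :
    Egte q.1 ≤ q.2 :=
  (isLeast_Egte (mem_hull_pureGraph hq).1).2 (mem_roofValues_iff.2 hq)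

theorem Egte_nonneg {ρ : Op a b c} (hρ : IsState ρ) : 0 ≤ Egte ρ :=
  (mem_hull_pureGraph (mk_Egte_mem_hull hρ)).2

theorem Egte_ketbra {ψ : Ket a b c} (hψ : ‖ψ‖ = 1) : Egte (ketbra ψ) = EgtePure ψ := by
  have hρ : IsState (ketbra ψ) := ⟨posSemidef_ketbra ψ, by rw [trace_ketbra, hψ]; simp⟩
  obtain ⟨n, p, φ, h, hv⟩ := (isLeast_Egte hρ).1
  rw [hv]
  calc ∑ i, p i * EgtePure (φ i) = ∑ i, p i * EgtePure ψ := by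
        refine Finset.sum_congr rfl fun i _ => ?_
        rcases eq_or_ne (p i) 0 with hi | hi
        · simp [hi]
        · obtain ⟨z, hz, hφ⟩ := h.exists_eq_smul hψ hi
          rw [EgtePure_eq_homEgte (h.norm_eq_one i), hφ, homEgte_smul, hz, one_mul,
            EgtePure_eq_homEgte hψ]
    _ = EgtePure ψ := by rw [← Finset.sum_mul, h.sum_eq_one, one_mul]

theorem Egte_eq_zero_of_isBiseparable {ρ : Op a b c} (hρ : IsState ρ) (h : IsBiseparable ρ) :
    Egte ρ = 0 := by
  obtain ⟨n, p, ψ, hdec, hbi⟩ := h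
  refine le_antisymm ((isLeast_Egte hρ).2 ⟨n, p, ψ, hdec, ?_⟩) (Egte_nonneg hρ)
  refine (Finset.sum_eq_zero fun i _ => ?_).symm
  rw [(EgtePure_eq_zero_iff (hdec.norm_eq_one i)).2 (hbi i), mul_zero]

theorem isBiseparable_of_Egte_eq_zero {ρ : Op a b c} (hρ : IsState ρ) (h : Egte ρ = 0) :
    IsBiseparable ρ := by
  obtain ⟨n, p, ψ, hdec, hv⟩ := (isLeast_Egte hρ).1
  rw [h] at hv
  have hbi : ∀ i, p i ≠ 0 → IsBiseparablePure (ψ i) := by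
    intro i hi
    have h1 := (Finset.sum_eq_zero_iff_of_nonneg fun j _ =>
      mul_nonneg (hdec.nonneg j) (EgtePure_nonneg (hdec.norm_eq_one j))).1 hv.symm i
        (Finset.mem_univ i)
    exact (EgtePure_eq_zero_iff (hdec.norm_eq_one i)).1 ((mul_eq_zero.1 h1).resolve_left hi)
  -- Vectors of weight zero are unconstrained and need not be biseparable; they are replaced by one
  -- of positive weight.
  obtain ⟨i₀, hi₀⟩ : ∃ i, p i ≠ 0 := by
    by_contra! hcon
    have := hdec.sum_eq_one
    simp [hcon] at this
  classical
  refine ⟨n, p, fun i => if p i = 0 then ψ i₀ else ψ i,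
    ⟨hdec.nonneg, hdec.sum_eq_one, fun i => ?_, ?_⟩, fun i => ?_⟩
  · split_ifs <;> exact hdec.norm_eq_one _
  · rw [hdec.eq_sum]
    refine Finset.sum_congr rfl fun i _ => ?_
    split_ifs with hi
    · rw [hi, zero_smul, zero_smul]
    · rfl
  · dsimp only
    split_ifs with hi
    · exact hbi _ hi₀
    · exact hbi _ hi

theorem convexOn_Egte : ConvexOn ℝ {ρ : Op a b c | IsState ρ} Egte := by
  have key : ∀ ρ σ : Op a b c, IsState ρ → IsState σ → ∀ s t : ℝ, 0 ≤ s → 0 ≤ t → s + t = 1 →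
      s • (ρ, Egte ρ) + t • (σ, Egte σ) ∈ convexHull ℝ (pureGraph a b c) :=
    fun ρ σ hρ hσ s t hs ht hst =>
      convex_convexHull ℝ _ (mk_Egte_mem_hull hρ) (mk_Egte_mem_hull hσ) hs ht hst
  exact ⟨fun ρ hρ σ hσ s t hs ht hst => (mem_hull_pureGraph (key ρ σ hρ hσ s t hs ht hst)).1,
    fun ρ hρ σ hσ s t hs ht hst => Egte_le_of_mem_hull (key ρ σ hρ hσ s t hs ht hst)⟩

end Roof

/-! ### Conjugation by Kraus operators. -/

section Conj

variable {ι κ : Type*} [Fintype ι]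

theorem conj_add (T : Matrix κ ι ℂ) (ρ σ : Matrix ι ι ℂ) : conj T (ρ + σ) = conj T ρ + conj T σ := by
  simp only [conj, Matrix.mul_add, Matrix.add_mul]

theorem conj_zero (T : Matrix κ ι ℂ) : conj T (0 : Matrix ι ι ℂ) = 0 := by simp [conj]

theorem conj_conj {μ : Type*} [Fintype κ] (S : Matrix μ κ ℂ) (T : Matrix κ ι ℂ)
    (ρ : Matrix ι ι ℂ) : conj S (conj T ρ) = conj (S * T) ρ := by
  simp only [conj, Matrix.conjTranspose_mul, Matrix.mul_assoc]

theorem sum_trace_conj [DecidableEq ι] {n : Type*} [Fintype n] {μ : n → Type*}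
    [∀ i, Fintype (μ i)] (T : ∀ i, Matrix (μ i) ι ℂ) (hT : ∑ i, (T i)ᴴ * T i = 1)
    (ρ : Matrix ι ι ℂ) : ∑ i, (conj (T i) ρ).trace = ρ.trace := by
  have h : ∀ i, (conj (T i) ρ).trace = ((T i)ᴴ * T i * ρ).trace := fun i => by
    rw [conj, Matrix.trace_mul_comm, ← Matrix.mul_assoc]
  simp only [h]
  rw [← Matrix.trace_sum, ← Finset.sum_mul, hT, Matrix.one_mul]

end Conj

theorem mk_sum_sum {n E F : Type*} [Fintype n] [AddCommMonoid E] [AddCommMonoid F] (f : n → E)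
    (g : n → F) : (∑ i, f i, ∑ i, g i) = ∑ i, (f i, g i) := by
  ext1
  · rw [Prod.fst_sum]
  · rw [Prod.snd_sum]

/-! ### Monotonicity under LOCC and local unitary invariance. -/

section LOCC

variable {a b c : ℕ}

theorem sum_trace_branch {k a' b' c' : ℕ} (P : Protocol k a' b' c' a b c) (ρ : Op a b c) :
    ∑ x, (P.branch x ρ).trace = ρ.trace := by
  induction P with
  | halt y => simp [Protocol.branch, apply_ite Matrix.trace]
  | @actA a b c n r K hK next ih =>
    simp only [Protocol.branch, Matrix.trace_sum]
    rw [Finset.sum_comm]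
    simp only [ih]
    refine sum_trace_conj _ ?_ ρ
    have h := sum_kronecker_one_of_kraus (κ := Fin b × Fin c) K hK
    simpa only [localOp, Matrix.one_kronecker_one] using h
  | actB r K hK next ih =>
    simp only [Protocol.branch, Matrix.trace_sum]
    rw [Finset.sum_comm]
    simp only [ih]
    exact sum_trace_conj _ (sum_one_kronecker_of_kraus _ (sum_kronecker_one_of_kraus K hK)) ρ
  | actC r K hK next ih =>
    simp only [Protocol.branch, Matrix.trace_sum]
    rw [Finset.sum_comm]
    simp only [ih]
    exact sum_trace_conj _ (sum_one_kronecker_of_kraus _ (sum_one_kronecker_of_kraus K hK)) ρ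

variable (a b c) in
/-- The pairs of an unnormalized state and the value of `homEgte` along one of its decompositions
into unnormalized pure states. -/
def ensembleCone (a' b' c' : ℕ) : AddSubmonoid (Op a b c × ℝ) :=
  AddSubmonoid.closure (Set.range fun ψ : Ket a b c => (ketbra ψ, homEgte a' b' c' ψ))

theorem mem_ensembleCone (a' b' c' : ℕ) (ψ : Ket a b c) :
    (ketbra ψ, homEgte a' b' c' ψ) ∈ ensembleCone a b c a' b' c' :=
  AddSubmonoid.subset_closure ⟨ψ, rfl⟩

/-- The conclusion is additive in `q`, so it need only be checked on the generating vectors, where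
it is the hypothesis `hT`. -/
theorem exists_conj_mem_ensembleCone {a' b' c' n : ℕ} {ra rb rc : Fin n → ℕ}
    (T : ∀ i, Matrix (Idx (ra i) (rb i) (rc i)) (Idx a b c) ℂ)
    (hT : ∀ ψ : Ket a b c, ∑ i, homEgte a' b' c' (a := ra i) (b := rb i) (c := rc i) (app (T i) ψ)
      ≤ homEgte a' b' c' ψ)
    {q : Op a b c × ℝ} (hq : q ∈ ensembleCone a b c a' b' c') :
    ∃ u : Fin n → ℝ, (∀ i, (conj (T i) q.1, u i) ∈ ensembleCone (ra i) (rb i) (rc i) a' b' c') ∧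
      ∑ i, u i ≤ q.2 := by
  induction hq using AddSubmonoid.closure_induction with
  | mem q hq =>
    obtain ⟨ψ, rfl⟩ := hq
    refine ⟨_, fun i => ?_, hT ψ⟩
    rw [conj_ketbra]
    exact mem_ensembleCone _ _ _ _
  | zero => exact ⟨0, fun i => by
      rw [Prod.fst_zero, conj_zero]
      exact (ensembleCone _ _ _ a' b' c').zero_mem, by simp⟩
  | add q q' _ _ h h' =>
    obtain ⟨u, hu, hs⟩ := h
    obtain ⟨u', hu', hs'⟩ := h'
    refine ⟨u + u', fun i => ?_, ?_⟩
    · have := AddSubmonoid.add_mem _ (hu i) (hu' i)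
      rwa [Prod.mk_add_mk, ← conj_add] at this
    · simp only [Pi.add_apply, Finset.sum_add_distrib]
      exact add_le_add hs hs'

theorem exists_branch_mem_of_forall {k a' b' c' n : ℕ} {ra rb rc : Fin n → ℕ}
    (σ : ∀ i, Op (ra i) (rb i) (rc i)) (next : ∀ i, Protocol k a' b' c' (ra i) (rb i) (rc i))
    (u : Fin n → ℝ) {v : ℝ} (huv : ∑ i, u i ≤ v)
    (h : ∀ i, ∃ w : Fin k → ℝ,
      (∀ x, ((next i).branch x (σ i), w x) ∈ ensembleCone a' b' c' a' b' c') ∧ ∑ x, w x ≤ u i) :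
    ∃ w : Fin k → ℝ, (∀ x, (∑ i, (next i).branch x (σ i), w x) ∈ ensembleCone a' b' c' a' b' c') ∧
      ∑ x, w x ≤ v := by
  choose w hw hwu using h
  refine ⟨fun x => ∑ i, w i x, fun x => ?_, ?_⟩
  · have := AddSubmonoid.sum_mem (ensembleCone a' b' c' a' b' c') fun i (_ : i ∈ Finset.univ) => hw i x
    rwa [← mk_sum_sum] at this
  · rw [Finset.sum_comm]
    exact (Finset.sum_le_sum fun i _ => hwu i).trans huv

/-- Induction on the protocol with the weights fixed at the target dimensions, whatever the current
ones are; the two agree when the protocol halts. -/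
theorem exists_branch_mem_ensembleCone {k a' b' c' : ℕ} (P : Protocol k a' b' c' a b c)
    (ρ : Op a b c) (v : ℝ) (hρ : (ρ, v) ∈ ensembleCone a b c a' b' c') :
    ∃ w : Fin k → ℝ, (∀ x, (P.branch x ρ, w x) ∈ ensembleCone a' b' c' a' b' c') ∧
      ∑ x, w x ≤ v := by
  induction P generalizing v with
  | halt y =>
    refine ⟨fun x => if y = x then v else 0, fun x => ?_, by simp⟩
    simp only [Protocol.branch]
    split_ifs
    · exact hρ
    · exact AddSubmonoid.zero_mem _
  | actA r K hK next ih =>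
    obtain ⟨u, hu, huv⟩ := exists_conj_mem_ensembleCone _
      (fun ψ => sum_homEgte_left_le a' b' c' ψ K hK) hρ
    exact exists_branch_mem_of_forall _ next u huv fun i => ih i _ _ (hu i)
  | actB r K hK next ih =>
    obtain ⟨u, hu, huv⟩ := exists_conj_mem_ensembleCone _
      (fun ψ => sum_homEgte_mid_le a' b' c' ψ K hK) hρ
    exact exists_branch_mem_of_forall _ next u huv fun i => ih i _ _ (hu i)
  | actC r K hK next ih =>
    obtain ⟨u, hu, huv⟩ := exists_conj_mem_ensembleCone _
      (fun ψ => sum_homEgte_right_le a' b' c' ψ K hK) hρ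
    exact exists_branch_mem_of_forall _ next u huv fun i => ih i _ _ (hu i)

theorem mem_ensembleCone_of_mem_hull {q : Op a b c × ℝ}
    (hq : q ∈ convexHull ℝ (pureGraph a b c)) : q ∈ ensembleCone a b c a b c := by
  obtain ⟨n, p, ψ, h, hv⟩ := mem_roofValues_iff.2 hq
  -- The probability enters the vector as its square root, because `homEgte` and `ketbra` are
  -- homogeneous of degree two.
  have hsum : q = ∑ i, (ketbra (((√(p i) : ℝ) : ℂ) • ψ i),
      homEgte a b c (((√(p i) : ℝ) : ℂ) • ψ i)) := by
    have hp : ∀ i, Complex.normSq ((√(p i) : ℝ) : ℂ) = p i := fun i => by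
      rw [Complex.normSq_ofReal, Real.mul_self_sqrt (h.nonneg i)]
    rw [← mk_sum_sum]
    ext1
    · simp only [ketbra_smul, hp]
      exact h.eq_sum
    · simp only [homEgte_smul, hp]
      rw [hv]
      exact Finset.sum_congr rfl fun i _ => by rw [EgtePure_eq_homEgte (h.norm_eq_one i)]
  rw [hsum]
  exact AddSubmonoid.sum_mem _ fun i _ => mem_ensembleCone _ _ _ _

/-- Returns from unnormalized ensembles to states: the cone lies over the hull. Nonemptiness is
needed only to represent the apex, as `0 • s`. -/
theorem exists_eq_smul_of_mem_ensembleCone (hne : (convexHull ℝ (pureGraph a b c)).Nonempty)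
    {q : Op a b c × ℝ} (hq : q ∈ ensembleCone a b c a b c) :
    ∃ t : ℝ, 0 ≤ t ∧ ∃ s ∈ convexHull ℝ (pureGraph a b c), q = t • s := by
  induction hq using AddSubmonoid.closure_induction with
  | mem q hq =>
    obtain ⟨ψ, rfl⟩ := hq
    rcases eq_or_ne ψ 0 with rfl | hψ
    · obtain ⟨s, hs⟩ := hne
      refine ⟨0, le_rfl, s, hs, ?_⟩
      have h0 : (0 : Ket a b c) = (0 : ℂ) • (0 : Ket a b c) := by simp
      dsimp only
      rw [h0, ketbra_smul, homEgte_smul]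
      simp
    · have hn : ‖ψ‖ ≠ 0 := norm_ne_zero_iff.2 hψ
      set φ : Ket a b c := ((‖ψ‖ : ℝ) : ℂ)⁻¹ • ψ with hφ
      have hφ1 : ‖φ‖ = 1 := by
        rw [hφ, norm_smul, norm_inv, Complex.norm_real, norm_norm, inv_mul_cancel₀ hn]
      have hψφ : ψ = ((‖ψ‖ : ℝ) : ℂ) • φ := by
        rw [hφ, smul_smul, mul_inv_cancel₀ (by exact_mod_cast hn), one_smul]
      refine ⟨Complex.normSq ((‖ψ‖ : ℝ) : ℂ), Complex.normSq_nonneg _, _,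
        subset_convexHull ℝ _ (mem_pureGraph hφ1), ?_⟩
      dsimp only
      rw [EgtePure_eq_homEgte hφ1, Prod.smul_mk, ← ketbra_smul, smul_eq_mul, ← homEgte_smul,
        ← hψφ]
  | zero =>
    obtain ⟨s, hs⟩ := hne
    exact ⟨0, le_rfl, s, hs, by simp⟩
  | add q q' _ _ h h' =>
    obtain ⟨t, ht, s, hs, rfl⟩ := h
    obtain ⟨t', ht', s', hs', rfl⟩ := h'
    obtain ⟨s'', hs'', h⟩ := (convex_convexHull ℝ _).exists_mem_add_smul_eq hs hs' ht ht'
    exact ⟨t + t', add_nonneg ht ht', s'', hs'', h.symm⟩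

theorem sum_prob_mul_Egte_post_le {k : ℕ} (P : Protocol k a b c a b c) {ρ : Op a b c}
    (hρ : IsState ρ) : ∑ x, P.prob x ρ * Egte (P.post x ρ) ≤ Egte ρ := by
  have hmem := mk_Egte_mem_hull hρ
  obtain ⟨w, hw, hsum⟩ :=
    exists_branch_mem_ensembleCone P ρ _ (mem_ensembleCone_of_mem_hull hmem)
  refine (Finset.sum_le_sum fun x _ => ?_).trans hsum
  obtain ⟨t, ht, s, hs, heq⟩ := exists_eq_smul_of_mem_ensembleCone ⟨_, hmem⟩ (hw x)
  have h1 : P.branch x ρ = t • s.1 := congrArg Prod.fst heq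
  have h2 : w x = t * s.2 := congrArg Prod.snd heq
  have hprob : P.prob x ρ = t := by
    simp [Protocol.prob, h1, (mem_hull_pureGraph hs).1.2]
  rw [h2, hprob]
  -- A record of probability zero contributes nothing, whatever value `post` takes there.
  rcases ht.eq_or_lt with h | h
  · simp [← h]
  · have hpost : P.post x ρ = s.1 := by
      rw [Protocol.post, hprob, h1, smul_smul, inv_mul_cancel₀ h.ne', one_smul]
    rw [hpost]
    exact mul_le_mul_of_nonneg_left (Egte_le_of_mem_hull hs) ht

/-- Forgetting the record adds the branches inside the cone; trace preservation then fixes the scale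
at one. -/
theorem channel_mem_hull {k : ℕ} (P : Protocol k a b c a b c) {ρ : Op a b c}
    (hρ : IsState ρ) : ∃ v ≤ Egte ρ, (P.channel ρ, v) ∈ convexHull ℝ (pureGraph a b c) := by
  have hmem := mk_Egte_mem_hull hρ
  obtain ⟨w, hw, hsum⟩ :=
    exists_branch_mem_ensembleCone P ρ _ (mem_ensembleCone_of_mem_hull hmem)
  have hch : (P.channel ρ, ∑ x, w x) ∈ ensembleCone a b c a b c := by
    rw [Protocol.channel, mk_sum_sum]
    exact AddSubmonoid.sum_mem _ fun x _ => hw x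
  obtain ⟨t, ht, s, hs, heq⟩ := exists_eq_smul_of_mem_ensembleCone ⟨_, hmem⟩ hch
  have htr : (P.channel ρ).trace = 1 := by
    rw [Protocol.channel, Matrix.trace_sum, sum_trace_branch, hρ.2]
  have h1 : P.channel ρ = t • s.1 := congrArg Prod.fst heq
  have ht1 : t = 1 := by
    rw [h1, Matrix.trace_smul, (mem_hull_pureGraph hs).1.2] at htr
    simpa using congrArg Complex.re htr
  refine ⟨_, hsum, ?_⟩
  rw [heq, ht1, one_smul]
  exact hs

theorem isState_channel {k : ℕ} (P : Protocol k a b c a b c) {ρ : Op a b c} (hρ : IsState ρ) :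
    IsState (P.channel ρ) := by
  obtain ⟨v, -, h⟩ := channel_mem_hull P hρ
  exact (mem_hull_pureGraph h).1

theorem Egte_channel_le {k : ℕ} (P : Protocol k a b c a b c) {ρ : Op a b c} (hρ : IsState ρ) :
    Egte (P.channel ρ) ≤ Egte ρ := by
  obtain ⟨v, hv, h⟩ := channel_mem_hull P hρ
  exact (Egte_le_of_mem_hull h).trans hv

variable (U : Matrix.unitaryGroup (Fin a) ℂ) (V : Matrix.unitaryGroup (Fin b) ℂ)
  (W : Matrix.unitaryGroup (Fin c) ℂ)

/-- The protocol in which each party applies a unitary. -/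
def unitaryProtocol : Protocol 1 a b c a b c :=
  .actA (n := 1) (fun _ => a) (fun _ => U) (by
      rw [Fin.sum_univ_one]; exact Matrix.mem_unitaryGroup_iff'.1 U.2)
    fun _ => .actB (n := 1) (fun _ => b) (fun _ => V)
      (by
      rw [Fin.sum_univ_one]; exact Matrix.mem_unitaryGroup_iff'.1 V.2)
      fun _ => .actC (n := 1) (fun _ => c) (fun _ => W)
        (by
      rw [Fin.sum_univ_one]; exact Matrix.mem_unitaryGroup_iff'.1 W.2) fun _ => .halt 0

theorem localOp_mul (K K' : Matrix (Fin a) (Fin a) ℂ) (L L' : Matrix (Fin b) (Fin b) ℂ)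
    (M M' : Matrix (Fin c) (Fin c) ℂ) :
    localOp K L M * localOp K' L' M' = localOp (K * K') (L * L') (M * M') := by
  simp only [localOp, Matrix.mul_kronecker_mul]

theorem channel_unitaryProtocol (ρ : Op a b c) :
    (unitaryProtocol U V W).channel ρ
      = conj (localOp (U : Matrix (Fin a) (Fin a) ℂ) (V : Matrix (Fin b) (Fin b) ℂ)
          (W : Matrix (Fin c) (Fin c) ℂ)) ρ := by
  have h : (unitaryProtocol U V W).channel ρ
      = conj (localOp (1 : Matrix (Fin a) (Fin a) ℂ) (1 : Matrix (Fin b) (Fin b) ℂ) (W : Matrix (Fin c) (Fin c) ℂ))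
        (conj (localOp (1 : Matrix (Fin a) (Fin a) ℂ) (V : Matrix (Fin b) (Fin b) ℂ)
          (1 : Matrix (Fin c) (Fin c) ℂ))
          (conj (localOp (U : Matrix (Fin a) (Fin a) ℂ) (1 : Matrix (Fin b) (Fin b) ℂ)
            (1 : Matrix (Fin c) (Fin c) ℂ)) ρ)) := by
    simp [Protocol.channel, unitaryProtocol, Protocol.branch]
  rw [h, conj_conj, conj_conj, localOp_mul, localOp_mul]
  simp

/-- A local unitary and its inverse are both LOCC maps, so monotonicity applies in both directions.
-/
theorem Egte_conj_localOp {ρ : Op a b c} (hρ : IsState ρ) :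
    Egte (conj (localOp (U : Matrix (Fin a) (Fin a) ℂ) (V : Matrix (Fin b) (Fin b) ℂ)
      (W : Matrix (Fin c) (Fin c) ℂ)) ρ) = Egte ρ := by
  rw [← channel_unitaryProtocol]
  refine le_antisymm (Egte_channel_le _ hρ) ?_
  have hinv : (unitaryProtocol U⁻¹ V⁻¹ W⁻¹).channel ((unitaryProtocol U V W).channel ρ) = ρ := by
    rw [channel_unitaryProtocol, channel_unitaryProtocol, conj_conj, localOp_mul,
      ← Matrix.UnitaryGroup.mul_val, ← Matrix.UnitaryGroup.mul_val, ← Matrix.UnitaryGroup.mul_val]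
    simp [localOp, conj]
  conv_lhs => rw [← hinv]
  exact Egte_channel_le _ (isState_channel _ hρ)

end LOCC

end GTE

end

theorem theorem5 (a b c : ℕ) :
    -- for every state the minimum in the convex roof is attained, and `Egte` is that minimum
    (∀ ρ : GTE.Op a b c, GTE.IsState ρ → IsLeast (GTE.roofValues ρ) (GTE.Egte ρ)) ∧
    -- on a pure state `Egte` is the geometric mean of the three bipartite values
    (∀ ψ : GTE.Ket a b c, ‖ψ‖ = 1 → GTE.Egte (GTE.ketbra ψ) = GTE.EgtePure ψ) ∧
    -- nonnegativity
    (∀ ρ : GTE.Op a b c, GTE.IsState ρ → 0 ≤ GTE.Egte ρ) ∧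
    -- vanishing on biseparable states
    (∀ ρ : GTE.Op a b c, GTE.IsState ρ → GTE.IsBiseparable ρ → GTE.Egte ρ = 0) ∧
    -- positivity on genuinely tripartite entangled states
    (∀ ρ : GTE.Op a b c, GTE.IsGenuinelyEntangled ρ → 0 < GTE.Egte ρ) ∧
    -- invariance under local unitaries
    (∀ (U : Matrix.unitaryGroup (Fin a) ℂ) (V : Matrix.unitaryGroup (Fin b) ℂ)
      (W : Matrix.unitaryGroup (Fin c) ℂ) (ρ : GTE.Op a b c), GTE.IsState ρ →
      GTE.Egte (GTE.conj (GTE.localOp (U : Matrix (Fin a) (Fin a) ℂ)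
        (V : Matrix (Fin b) (Fin b) ℂ) (W : Matrix (Fin c) (Fin c) ℂ)) ρ) = GTE.Egte ρ) ∧
    -- convexity on the set of states
    ConvexOn ℝ {ρ : GTE.Op a b c | GTE.IsState ρ} GTE.Egte ∧
    -- no increase on average under stochastic LOCC
    (∀ (k : ℕ) (P : GTE.Protocol k a b c a b c) (ρ : GTE.Op a b c), GTE.IsState ρ →
      ∑ x, P.prob x ρ * GTE.Egte (P.post x ρ) ≤ GTE.Egte ρ) ∧
    -- no increase under LOCC maps
    (∀ (k : ℕ) (P : GTE.Protocol k a b c a b c) (ρ : GTE.Op a b c), GTE.IsState ρ →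
      GTE.Egte (P.channel ρ) ≤ GTE.Egte ρ) := by
  refine ⟨fun ρ hρ => GTE.isLeast_Egte hρ, fun ψ hψ => GTE.Egte_ketbra hψ,
    fun ρ hρ => GTE.Egte_nonneg hρ, fun ρ hρ h => GTE.Egte_eq_zero_of_isBiseparable hρ h,
    fun ρ h => (GTE.Egte_nonneg h.1).lt_of_ne' fun h0 =>
      h.2 (GTE.isBiseparable_of_Egte_eq_zero h.1 h0),
    fun U V W ρ hρ => GTE.Egte_conj_localOp U V W hρ, GTE.convexOn_Egte,
    fun k P ρ hρ => GTE.sum_prob_mul_Egte_post_le P hρ, fun k P ρ hρ => GTE.Egte_channel_le P hρ⟩
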